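/- Let $n\ge 0$ be an integer. A complete flag $F$ in $\mathbb{C}^n$ is a chain of subspaces $F^0\subset F^1\subset\dots\subset F^n$ with $\dim F^j=j$; let $\mathcal{F}(\mathbb{C}^n)$ be the set of complete flags. Let $v_3$ be the volume of a maximal (equivalently, regular) ideal tetrahedron in hyperbolic $3$-space $\mathbb{H}^3$, and let $\mathrm{Vol}_{\mathbb{H}^3}:\mathbb{P}(\mathbb{C}^2)^4\to\mathbb{R}$ be the signed hyperbolic volume of ideal simplices with vertices in $\partial\mathbb{H}^3=\mathbb{P}(\mathbb{C}^2)=\mathbb{C}\cup\{\infty\}$, the simplex $(\infty,0,1,z)$ being positively oriented when $\operatorname{Im} z>0$. For a finite-dimensional complex vector space $V$ and vectors $x_0,\dots,x_3$ spanning $V$, set $$\mathrm{Vol}[V;(x_0,\dots,x_3)]=\mathrm{Vol}_{\mathbb{H}^3}([x_0],\dots,[x_3])$$ if $\dim V=2$ and all $x_i\neq 0$ (where $V$ is identified with $\mathbb{C}^2$ by any linear isomorphism), and $\mathrm{Vol}[V;(x_0,\dots,x_3)]=0$ otherwise. For $F_0,\dots,F_3\in\mathcal{F}(\mathbb{C}^n)$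 choose vectors $v_i^j$ with $F_i^j=\mathbb{C}v_i^j+F_i^{j-1}$ for $1\le j\le n$, and define $$B_n(F_0,\dots,F_3)=\sum_{(j_0,\dots,j_3)\in\{0,\dots,n-1\}^4}\mathrm{Vol}\left[\frac{\langle F_0^{j_0+1},\dots,F_3^{j_3+1}\rangle}{\langle F_0^{j_0},\dots,F_3^{j_3}\rangle};(v_0^{j_0+1},\dots,v_3^{j_3+1})\right],$$ where in each summand the vectors are replaced by their images in the quotient; the sum does not depend on the choice of the $v_i^j$. Let $F_0,F_1,F_2,F_3\in\mathcal{F}(\mathbb{C}^n)$ be a maximal $4$-tuple, in the sense that $$|B_n(F_0,F_1,F_2,F_3)|=\tfrac16\,n(n^2-1)\,v_3.$$ If $F\in\mathcal{F}(\mathbb{C}^n)$ satisfies $B_n(F_0,F_1,F_2,F)=B_n(F_0,F_1,F_2,F_3)$, then $F=F_3$. -/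

import Mathlib

noncomputable section

namespace FlagVolume

/-! ## Hyperbolic 3-space and ideal simplices

`ℍ³` is the upper half-space `{(w, t) ∈ ℂ × ℝ : 0 < t}`; its ideal boundary is `ℙ(ℂ²)`, where
`[z : 1]` corresponds to `z ∈ ℂ` and `[1 : 0]` to `∞`. -/

/-- Upper half-space, as a subset of `ℂ × ℝ`. -/
def upperHalfSpace : Set (ℂ × ℝ) := {p | 0 < p.2}

/-- The hyperbolic volume measure `t⁻³ dw dt` on upper half-space (curvature `-1`). -/
def hyperbolicVolume : MeasureTheory.Measure (ℂ × ℝ) :=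
  (MeasureTheory.volume.restrict upperHalfSpace).withDensity
    (fun p => ENNReal.ofReal ((p.2 ^ 3)⁻¹))

/-- The standard isometry from upper half-space onto the hyperboloid model, consisting of the
positive definite Hermitian `2 × 2` matrices of determinant one (the quadratic form `det` on
Hermitian matrices has signature `(1, 3)`). -/
def toHyperboloid (p : ℂ × ℝ) : Matrix (Fin 2) (Fin 2) ℂ :=
  ((p.2⁻¹ : ℝ) : ℂ) •
    !![((‖p.1‖ ^ 2 + p.2 ^ 2 : ℝ) : ℂ), p.1; (starRingEnd ℂ) p.1, 1]

/-- The light-like Hermitian matrix `v v*`; its ray is the ideal point `[v] ∈ ℙ(ℂ²) = ∂ℍ³`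
in the hyperboloid model. -/
def lightVector (v : Fin 2 → ℂ) : Matrix (Fin 2) (Fin 2) ℂ :=
  Matrix.vecMulVec v (star v)

/-- The ideal simplex with vertices `[v 0], …, [v 3] ∈ ∂ℍ³`, i.e. the hyperbolic convex hull of
these ideal points. In the hyperboloid model it is the intersection of the hyperboloid with the
convex cone spanned by the corresponding light rays. -/
def idealSimplex (v : Fin 4 → Fin 2 → ℂ) : Set (ℂ × ℝ) :=
  {p | p ∈ upperHalfSpace ∧ ∃ c : Fin 4 → ℝ, (∀ i, 0 ≤ c i) ∧
    toHyperboloid p = ∑ i, (c i : ℂ) • lightVector (v i)}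

/-- The (unsigned) hyperbolic volume of the ideal simplex with vertices `[v i]`. -/
def simplexVolume (v : Fin 4 → Fin 2 → ℂ) : ℝ :=
  (hyperbolicVolume (idealSimplex v)).toReal

/-- The determinant of two vectors of `ℂ²`. -/
def det₂ (u v : Fin 2 → ℂ) : ℂ := u 0 * v 1 - u 1 * v 0

/-- The cross-ratio, normalised so that `(∞, 0, 1, z)` has cross-ratio `z`. When two of the four
points coincide its value (possibly through division by zero) is `0` or `1`, hence real. -/
def crossRatio (v : Fin 4 → Fin 2 → ℂ) : ℂ :=
  (det₂ (v 0) (v 2) * det₂ (v 1) (v 3)) / (det₂ (v 0) (v 3) * det₂ (v 1) (v 2))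

/-- The signed hyperbolic volume of the ideal simplex with vertices `[v 0], …, [v 3]`. The simplex
with vertices `∞, 0, 1, z` is positively oriented iff `0 < Im z`, and flat iff `Im z = 0`. -/
def volH3 (v : Fin 4 → Fin 2 → ℂ) : ℝ :=
  Real.sign (crossRatio v).im * simplexVolume v

/-- The volume `v₃` of a maximal ideal tetrahedron of `ℍ³`. -/
def v₃ : ℝ :=
  sSup {r : ℝ | ∃ v : Fin 4 → Fin 2 → ℂ, (∀ i, v i ≠ 0) ∧ r = simplexVolume v}

open Classical in
/-- The function `Vol` on 4-tuples of vectors spanning a finite-dimensional complex vector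
space `V`: if `dim V = 2` and no vector vanishes, it is the signed volume of the ideal simplex that
the vectors define after identifying `V` with `ℂ²` (the choice of the identification is immaterial,
since `GL(2, ℂ)` acts on `ℍ³ ∪ ∂ℍ³` by orientation-preserving isometries); otherwise it is `0`. -/
def Vol (V : Type*) [AddCommGroup V] [Module ℂ V] [FiniteDimensional ℂ V] (x : Fin 4 → V) : ℝ :=
  if h : Module.finrank ℂ V = 2 then
    if ∀ i, x i ≠ 0 then
      volH3 (fun i => (Module.finBasisOfFinrankEq ℂ V h).equivFun (x i))
    else 0
  else 0

/-! ## Flags and affine flags -/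

/-- A complete flag `F⁰ ⊂ F¹ ⊂ ⋯ ⊂ Fⁿ` in `ℂⁿ` with `dim Fʲ = j`. -/
@[ext]
structure CompleteFlag (n : ℕ) where
  subspace : Fin (n + 1) → Submodule ℂ (Fin n → ℂ)
  monotone_subspace : Monotone subspace
  finrank_subspace : ∀ j, Module.finrank ℂ (subspace j) = j

/-- An affine flag: a complete flag with vectors such that `Fʲ⁺¹ = ℂ vʲ⁺¹ + Fʲ`. The vector
`vʲ⁺¹` is `vec j`, for `j = 0, …, n - 1`. -/
structure AffineFlag (n : ℕ) extends CompleteFlag n where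
  vec : Fin n → (Fin n → ℂ)
  subspace_succ : ∀ j : Fin n,
    subspace j.succ = Submodule.span ℂ {vec j} ⊔ subspace j.castSucc

variable {n : ℕ}

/-- The span `⟨F₀^{j₀}, …, F₃^{j₃}⟩`. -/
def lowerSpan (F : Fin 4 → AffineFlag n) (J : Fin 4 → Fin n) : Submodule ℂ (Fin n → ℂ) :=
  ⨆ i, (F i).subspace (J i).castSucc

/-- The span `⟨F₀^{j₀+1}, …, F₃^{j₃+1}⟩`. -/
def upperSpan (F : Fin 4 → AffineFlag n) (J : Fin 4 → Fin n) : Submodule ℂ (Fin n → ℂ) :=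
  ⨆ i, (F i).subspace (J i).succ

theorem vec_mem_upperSpan (F : Fin 4 → AffineFlag n) (J : Fin 4 → Fin n) (i : Fin 4) :
    (F i).vec (J i) ∈ upperSpan F J := by
  have h : (F i).vec (J i) ∈ (F i).subspace (J i).succ := by
    rw [(F i).subspace_succ]
    exact Submodule.mem_sup_left (Submodule.mem_span_singleton_self _)
  exact Submodule.mem_iSup_of_mem i h

/-- The quotient `⟨F₀^{j₀+1}, …, F₃^{j₃+1}⟩ / ⟨F₀^{j₀}, …, F₃^{j₃}⟩`. -/
abbrev spanQuotient (F : Fin 4 → AffineFlag n) (J : Fin 4 → Fin n) : Type :=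
  upperSpan F J ⧸ (lowerSpan F J).submoduleOf (upperSpan F J)

/-- The class of `vᵢ^{jᵢ+1}` in the quotient. -/
def quotientVec (F : Fin 4 → AffineFlag n) (J : Fin 4 → Fin n) (i : Fin 4) : spanQuotient F J :=
  Submodule.Quotient.mk ⟨(F i).vec (J i), vec_mem_upperSpan F J i⟩

/-- The cocycle `B_n` on 4-tuples of affine flags. -/
def affineB (F : Fin 4 → AffineFlag n) : ℝ :=
  ∑ J : Fin 4 → Fin n, Vol (spanQuotient F J) (quotientVec F J)

/-- Every complete flag underlies an affine flag. -/
theorem CompleteFlag.exists_affineFlag (F : CompleteFlag n) :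
    ∃ A : AffineFlag n, A.toCompleteFlag = F := by
  have key : ∀ j : Fin n, ∃ v : Fin n → ℂ,
      F.subspace j.succ = Submodule.span ℂ {v} ⊔ F.subspace j.castSucc := by
    intro j
    have hle : F.subspace j.castSucc ≤ F.subspace j.succ :=
      F.monotone_subspace (Fin.castSucc_lt_succ (i := j)).le
    have h1 := F.finrank_subspace j.castSucc
    have h2 := F.finrank_subspace j.succ
    simp only [Fin.val_castSucc, Fin.val_succ] at h1 h2
    have hlt : F.subspace j.castSucc < F.subspace j.succ := by
      refine lt_of_le_of_ne hle fun h => ?_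
      rw [h] at h1
      omega
    obtain ⟨v, hv, hv'⟩ := SetLike.exists_of_lt hlt
    refine ⟨v, (Submodule.eq_of_le_of_finrank_le ?_ ?_).symm⟩
    · exact sup_le ((Submodule.span_singleton_le_iff_mem _ _).2 hv) hle
    · have hlt' : F.subspace j.castSucc < Submodule.span ℂ {v} ⊔ F.subspace j.castSucc := by
        refine lt_of_le_of_ne le_sup_right fun h => hv' ?_
        rw [h]
        exact Submodule.mem_sup_left (Submodule.mem_span_singleton_self _)
      have := Submodule.finrank_lt_finrank_of_lt hlt'
      omega
  choose v hv using key
  exact ⟨{ F with vec := v, subspace_succ := hv }, rfl⟩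

/-- An affine flag over a given complete flag. -/
def CompleteFlag.toAffine (F : CompleteFlag n) : AffineFlag n := F.exists_affineFlag.choose

/-- The function `B_n` on 4-tuples of complete flags, induced by the one on affine flags (the
lifts are immaterial, since `Vol` only depends on the lines spanned by the vectors). -/
def B (F : Fin 4 → CompleteFlag n) : ℝ := affineB (fun i => (F i).toAffine)

end FlagVolume

end

noncomputable section

namespace FlagVolume

section

open MeasureTheory

/-! ## Isometries of upper half-space -/

/-! Two ingredients: three vertices and the orientation determine the fourth vertex of a maximal
ideal tetrahedron, and a maximal tuple has a maximal term for every admissible choice of dimensions.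

Geometry. Isometries move any nondegenerate ideal simplex to `∞, 0, 1, z`, and complex conjugation
reduces to `Im z > 0`. Integration over the triangle `0, 1, z` with angles `a, b, c` gives
Lobachevsky's formula (`hyperbolicVolume_idealSimplex_thirdVertex`), whose strict maximum over angle
triples is at `π / 3, π / 3, π / 3` (`angleVolume_lt`). Hence maximal volume together with its sign
fixes the cross-ratio, so two maximal simplices of equal sign that share three vertices share the
fourth (`det₂_eq_zero_of_volH3_eq`).

Counting. A nonzero term `J` lives in a plane in which the four vectors are pairwise independent.
Let `d₁ = J 3`, and let `d₂`, `d₃` be the dimensions of the spans obtained by adding the members of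
flag 0 and then of flag 1. Then `d₁ ≤ d₂ ≤ d₃ ≤ n - 2`, and the triple determines `J`
(`index_eq_of_term_ne_zero`). There are `n(n² - 1)/6` such triples, each term is at most `v₃` in
absolute value, so in a maximal tuple every triple occurs and all nonzero terms equal the same `±v₃`
(`maximal_terms`).

Rigidity. Suppose the two last flags agree up to level `k`, with common member `G` and next vectors
`x`, `y`. For each `d` with `k ≤ d ≤ n - 2` both tuples have a nonzero term at the same index with
`d₁ = k`, `d₂ = d`, `d₃ = n - 2`; the geometry puts `y - r x` in its lower span for some `r`
(`exists_common_index`). For `d = n - 2` this span is `G` plus a member of flag 0. Smaller values of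
`d` strip off the steps of flag 0 one at a time until `y - r x ∈ G`, so the flags agree at level `k
+ 1` (`subspace_succ_eq`). -/

theorem measurableSet_upperHalfSpace : MeasurableSet upperHalfSpace :=
  measurableSet_lt measurable_const measurable_snd

theorem hyperbolicVolume_apply (s : Set (ℂ × ℝ)) (hs : MeasurableSet s) :
    hyperbolicVolume s = ∫⁻ p in s ∩ upperHalfSpace, ENNReal.ofReal ((p.2 ^ 3)⁻¹) := by
  rw [hyperbolicVolume, withDensity_apply _ hs, Measure.restrict_restrict hs]

instance isAddHaarMeasure_volume : (volume : Measure (ℂ × ℝ)).IsAddHaarMeasure := by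
  rw [Measure.volume_eq_prod]
  infer_instance

/-- Change of variables against the density `t⁻³`. The derivative is only needed on upper
half-space, which carries the measure. -/
theorem measurePreserving_hyperbolicVolume (e : (ℂ × ℝ) ≃ᵐ (ℂ × ℝ))
    (f' : ℂ × ℝ → (ℂ × ℝ) →L[ℝ] (ℂ × ℝ))
    (hf : ∀ p ∈ upperHalfSpace, HasFDerivAt e (f' p) p)
    (hU : ∀ p, e p ∈ upperHalfSpace ↔ p ∈ upperHalfSpace)
    (hdet : ∀ p ∈ upperHalfSpace, |(f' p).det| * (((e p).2 ^ 3)⁻¹) = (p.2 ^ 3)⁻¹) :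
    MeasurePreserving e hyperbolicVolume hyperbolicVolume := by
  refine ⟨e.measurable, Measure.ext fun s hs => ?_⟩
  have hs' : MeasurableSet (e ⁻¹' s) := e.measurable hs
  rw [Measure.map_apply e.measurable hs, hyperbolicVolume_apply _ hs', hyperbolicVolume_apply _ hs]
  have himg : s ∩ upperHalfSpace = e '' (e ⁻¹' s ∩ upperHalfSpace) := by
    ext q
    constructor
    · rintro ⟨h1, h2⟩
      refine ⟨e.symm q, ⟨by simpa using h1, (hU _).1 (by simpa using h2)⟩, by simp⟩
    · rintro ⟨p, ⟨h1, h2⟩, rfl⟩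
      exact ⟨h1, (hU p).2 h2⟩
  have hm := hs'.inter measurableSet_upperHalfSpace
  rw [himg, lintegral_image_eq_lintegral_abs_det_fderiv_mul volume hm
    (fun p hp => (hf p hp.2).hasFDerivWithinAt) (e.injective.injOn)]
  refine setLIntegral_congr_fun hm fun p hp => ?_
  rw [← ENNReal.ofReal_mul (abs_nonneg _), hdet p hp.2]

/-- The isometry `(w, t) ↦ (a w + b, |a| t)`. -/
def similarityEquiv (a b : ℂ) (ha : a ≠ 0) : (ℂ × ℝ) ≃ᵐ (ℂ × ℝ) where
  toFun p := (a * p.1 + b, ‖a‖ * p.2)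
  invFun p := (a⁻¹ * (p.1 - b), ‖a‖⁻¹ * p.2)
  left_inv p := by
    have : ‖a‖ ≠ 0 := norm_ne_zero_iff.2 ha
    ext <;> simp [ha]
  right_inv p := by
    have : ‖a‖ ≠ 0 := norm_ne_zero_iff.2 ha
    ext <;> simp [ha]
  measurable_toFun := by
    simp only [Equiv.coe_fn_mk]
    fun_prop
  measurable_invFun := by
    simp only [Equiv.coe_fn_symm_mk]
    fun_prop

theorem similarityEquiv_apply (a b : ℂ) (ha : a ≠ 0) (p : ℂ × ℝ) :
    similarityEquiv a b ha p = (a * p.1 + b, ‖a‖ * p.2) := rfl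

theorem measurePreserving_similarityEquiv (a b : ℂ) (ha : a ≠ 0) :
    MeasurePreserving (similarityEquiv a b ha) hyperbolicVolume hyperbolicVolume := by
  have ha' : 0 < ‖a‖ := norm_pos_iff.2 ha
  let g : (ℂ × ℝ) →ₗ[ℝ] (ℂ × ℝ) :=
    LinearMap.prodMap ((LinearMap.mulLeft ℂ a).restrictScalars ℝ) (LinearMap.mulLeft ℝ ‖a‖)
  refine measurePreserving_hyperbolicVolume _ (fun _ => LinearMap.toContinuousLinearMap g) ?_ ?_ ?_
  · intro p _
    have h := (LinearMap.toContinuousLinearMap g).hasFDerivAt (x := p)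
    exact h.add_const ((b, 0) : ℂ × ℝ) |>.congr_of_eventuallyEq
      (Filter.Eventually.of_forall fun q => by simp [similarityEquiv_apply, g])
  · intro p
    simp [upperHalfSpace, similarityEquiv_apply, ha']
  · intro p hp
    have hd : (LinearMap.toContinuousLinearMap g).det = ‖a‖ ^ 3 := by
      rw [ContinuousLinearMap.det, LinearMap.coe_toContinuousLinearMap, LinearMap.det_prodMap,
        LinearMap.det_restrictScalars, LinearMap.det_ring, LinearMap.det_ring,
        Algebra.norm_complex_eq]
      simp [Complex.normSq_eq_norm_sq]
      ring
    have hp' : 0 < p.2 := hp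
    rw [hd, similarityEquiv_apply, abs_of_pos (by positivity)]
    field_simp

/-- The isometry `(w, t) ↦ (conj w, t)`. -/
def conjEquiv : (ℂ × ℝ) ≃ᵐ (ℂ × ℝ) where
  toFun p := ((starRingEnd ℂ) p.1, p.2)
  invFun p := ((starRingEnd ℂ) p.1, p.2)
  left_inv p := by simp
  right_inv p := by simp
  measurable_toFun := by
    simp only [Equiv.coe_fn_mk]
    fun_prop
  measurable_invFun := by
    simp only [Equiv.coe_fn_symm_mk]
    fun_prop

theorem conjEquiv_apply (p : ℂ × ℝ) : conjEquiv p = ((starRingEnd ℂ) p.1, p.2) := rfl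

theorem measurePreserving_conjEquiv :
    MeasurePreserving conjEquiv hyperbolicVolume hyperbolicVolume := by
  let g : (ℂ × ℝ) →ₗ[ℝ] (ℂ × ℝ) :=
    LinearMap.prodMap Complex.conjAe.toLinearMap LinearMap.id
  refine measurePreserving_hyperbolicVolume _ (fun _ => LinearMap.toContinuousLinearMap g) ?_ ?_ ?_
  · intro p _
    exact (LinearMap.toContinuousLinearMap g).hasFDerivAt (x := p)
  · intro p
    simp [upperHalfSpace, conjEquiv_apply]
  · intro p hp
    have hd : (LinearMap.toContinuousLinearMap g).det = -1 := by
      rw [ContinuousLinearMap.det, LinearMap.coe_toContinuousLinearMap, LinearMap.det_prodMap,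
        LinearMap.det_id]
      simp [Complex.det_conjAe]
    rw [hd, conjEquiv_apply]
    simp

/-- The inversion `(w, t) ↦ (w, t) / (|w|² + t²)` in the unit hemisphere. -/
def inversionFun (p : ℂ × ℝ) : ℂ × ℝ := (‖p.1‖ ^ 2 + p.2 ^ 2)⁻¹ • p

theorem inversionFun_involutive : Function.Involutive inversionFun := by
  intro p
  unfold inversionFun
  rcases eq_or_ne p 0 with rfl | hp
  · simp
  have hA : ‖p.1‖ ^ 2 + p.2 ^ 2 ≠ 0 := by
    intro h
    apply hp
    have h1 : ‖p.1‖ ^ 2 = 0 := by nlinarith [sq_nonneg ‖p.1‖, sq_nonneg p.2]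
    have h2 : p.2 ^ 2 = 0 := by nlinarith [sq_nonneg ‖p.1‖, sq_nonneg p.2]
    ext1
    · simpa using h1
    · simpa using h2
  set A := ‖p.1‖ ^ 2 + p.2 ^ 2 with hAdef
  have : ‖(A⁻¹ • p).1‖ ^ 2 + (A⁻¹ • p).2 ^ 2 = A⁻¹ := by
    rw [Prod.smul_fst, Prod.smul_snd, norm_smul, smul_eq_mul, mul_pow, mul_pow, Real.norm_eq_abs,
      sq_abs, ← mul_add, ← hAdef]
    field_simp
  rw [this, inv_inv, smul_smul, mul_inv_cancel₀ hA, one_smul]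

/-- The inversion in the unit hemisphere, as a measurable equivalence. -/
def inversionEquiv : (ℂ × ℝ) ≃ᵐ (ℂ × ℝ) where
  toEquiv := inversionFun_involutive.toPerm
  measurable_toFun := by
    change Measurable inversionFun
    unfold inversionFun
    fun_prop
  measurable_invFun := by
    change Measurable inversionFun
    unfold inversionFun
    fun_prop

theorem inversionEquiv_apply (p : ℂ × ℝ) :
    inversionEquiv p = (‖p.1‖ ^ 2 + p.2 ^ 2)⁻¹ • p := rfl

theorem measurePreserving_inversionEquiv :
    MeasurePreserving inversionEquiv hyperbolicVolume hyperbolicVolume := by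
  -- The product `ℂ × ℝ` carries the sup norm; in the `L²` product the map is a Euclidean inversion,
  -- whose derivative is a reflection scaled by the inverse square of the norm.
  let e := WithLp.prodContinuousLinearEquiv 2 ℝ ℂ ℝ
  have hnorm : ∀ p : ℂ × ℝ, ‖e.symm p‖ ^ 2 = ‖p.1‖ ^ 2 + p.2 ^ 2 := fun p => by
    rw [WithLp.prod_norm_sq_eq_of_L2]
    simp [e]
  have hinv : ∀ p, inversionEquiv p = e (EuclideanGeometry.inversion 0 1 (e.symm p)) := fun p => by
    simp [inversionEquiv_apply, EuclideanGeometry.inversion, hnorm]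
  let f' : ℂ × ℝ → (ℂ × ℝ) →L[ℝ] (ℂ × ℝ) := fun p =>
    (e : WithLp 2 (ℂ × ℝ) →L[ℝ] (ℂ × ℝ)) ∘L
      (((1 / dist (e.symm p) 0) ^ 2 • ((ℝ ∙ (e.symm p - 0))ᗮ.reflection :
        WithLp 2 (ℂ × ℝ) →L[ℝ] WithLp 2 (ℂ × ℝ))) ∘L
        (e.symm : (ℂ × ℝ) →L[ℝ] WithLp 2 (ℂ × ℝ)))
  have hpos : ∀ p ∈ upperHalfSpace, 0 < ‖p.1‖ ^ 2 + p.2 ^ 2 := fun p hp => by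
    have : 0 < p.2 := hp
    positivity
  refine measurePreserving_hyperbolicVolume _ f' ?_ ?_ ?_
  · intro p hp
    have hne : e.symm p ≠ 0 := by
      intro h
      have := hnorm p
      rw [h] at this
      simp only [norm_zero] at this
      linarith [hpos p hp]
    have h := EuclideanGeometry.hasFDerivAt_inversion (R := 1) hne
    exact (e.hasFDerivAt.comp p (h.comp p e.symm.hasFDerivAt)).congr_of_eventuallyEq
      (Filter.Eventually.of_forall hinv)
  · intro p
    rw [inversionEquiv_apply]
    simp only [upperHalfSpace, Set.mem_ofPred_eq, Prod.smul_snd, smul_eq_mul]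
    constructor
    · intro h
      by_contra h'
      rw [not_lt] at h'
      have : (‖p.1‖ ^ 2 + p.2 ^ 2)⁻¹ * p.2 ≤ 0 :=
        mul_nonpos_of_nonneg_of_nonpos (by positivity) h'
      linarith
    · intro h
      have := hpos p h
      positivity
  · intro p hp
    have hA := hpos p hp
    have hp' : 0 < p.2 := hp
    have hfin : Module.finrank ℝ (WithLp 2 (ℂ × ℝ)) = 3 := by
      rw [e.toLinearEquiv.finrank_eq, Module.finrank_prod]
      simp
    have hd : |(f' p).det| = ((‖p.1‖ ^ 2 + p.2 ^ 2)⁻¹) ^ 3 := by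
      have h1 : (f' p).det = LinearMap.det ((1 / dist (e.symm p) 0) ^ 2 •
          ((ℝ ∙ (e.symm p - 0))ᗮ.reflection.toLinearEquiv :
            WithLp 2 (ℂ × ℝ) →ₗ[ℝ] WithLp 2 (ℂ × ℝ))) :=
        LinearMap.det_conj _ e.toLinearEquiv
      rw [h1, LinearMap.det_smul, Submodule.det_reflection, hfin, abs_mul, abs_neg_one_pow,
        mul_one, dist_zero_right, abs_of_nonneg (by positivity), one_div, inv_pow,
        hnorm]
    rw [hd, inversionEquiv_apply]
    simp only [Prod.smul_snd, smul_eq_mul]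
    field_simp

end

section

open MeasureTheory Matrix

/-! ## Invariance of the volume of ideal simplices -/

theorem simplexVolume_eq_of_equiv {v v' : Fin 4 → Fin 2 → ℂ} (e : (ℂ × ℝ) ≃ᵐ (ℂ × ℝ))
    (he : MeasurePreserving e hyperbolicVolume hyperbolicVolume)
    (h : ∀ p, e p ∈ idealSimplex v' ↔ p ∈ idealSimplex v) :
    simplexVolume v' = simplexVolume v := by
  have : e ⁻¹' idealSimplex v' = idealSimplex v := Set.ext h
  rw [simplexVolume, simplexVolume, ← this, he.measure_preimage_equiv]

theorem lightVector_apply (v : Fin 2 → ℂ) (i j : Fin 2) :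
    lightVector v i j = v i * (starRingEnd ℂ) (v j) := rfl

theorem lightVector_smul (c : ℂ) (v : Fin 2 → ℂ) :
    lightVector (c • v) = ((‖c‖ ^ 2 : ℝ) : ℂ) • lightVector v := by
  have hc : ((‖c‖ ^ 2 : ℝ) : ℂ) = c * star c := by
    rw [← Complex.normSq_eq_norm_sq, ← Complex.mul_conj]; rfl
  rw [lightVector, lightVector, star_smul, smul_vecMulVec, vecMulVec_smul, smul_smul, hc]

theorem lightVector_mulVec (g : Matrix (Fin 2) (Fin 2) ℂ) (v : Fin 2 → ℂ) :
    lightVector (g *ᵥ v) = g * lightVector v * gᴴ := by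
  rw [lightVector, lightVector, star_mulVec, mul_vecMulVec, vecMulVec_mul]

theorem idealSimplex_smul_subset (v : Fin 4 → Fin 2 → ℂ) (c : Fin 4 → ℂ) :
    idealSimplex (fun i => c i • v i) ⊆ idealSimplex v := by
  rintro p ⟨hp, k, hk, h⟩
  refine ⟨hp, fun i => k i * ‖c i‖ ^ 2, fun i => mul_nonneg (hk i) (by positivity), ?_⟩
  rw [h]
  refine Finset.sum_congr rfl fun i _ => ?_
  rw [lightVector_smul, smul_smul, Complex.ofReal_mul]

theorem simplexVolume_smul (v : Fin 4 → Fin 2 → ℂ) (c : Fin 4 → ℂ) (hc : ∀ i, c i ≠ 0) :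
    simplexVolume (fun i => c i • v i) = simplexVolume v := by
  have : idealSimplex (fun i => c i • v i) = idealSimplex v := by
    refine (idealSimplex_smul_subset v c).antisymm ?_
    have := idealSimplex_smul_subset (fun i => c i • v i) (fun i => (c i)⁻¹)
    simpa [smul_smul, hc] using this
  rw [simplexVolume, simplexVolume, this]

/-- The action `H ↦ g H gᴴ` on Hermitian matrices carries the light ray of `v` to that of `g v`. The
factor `k` compensates for `|det g| ≠ 1`; cones do not notice it. -/
theorem mem_idealSimplex_mulVec_iff (g h : Matrix (Fin 2) (Fin 2) ℂ) (hg : h * g = 1)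
    (v : Fin 4 → Fin 2 → ℂ) (p q : ℂ × ℝ) (hU : q ∈ upperHalfSpace ↔ p ∈ upperHalfSpace)
    (hpq : p ∈ upperHalfSpace →
      ∃ k : ℝ, 0 < k ∧ toHyperboloid q = (k : ℂ) • (g * toHyperboloid p * gᴴ)) :
    q ∈ idealSimplex (fun i => g *ᵥ v i) ↔ p ∈ idealSimplex v := by
  constructor
  · rintro ⟨hq, c, hc, hs⟩
    have hp := hU.1 hq
    obtain ⟨k, hk, hkq⟩ := hpq hp
    refine ⟨hp, fun i => k⁻¹ * c i, fun i => mul_nonneg (inv_nonneg.2 hk.le) (hc i), ?_⟩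
    have hg' : gᴴ * hᴴ = 1 := by rw [← conjTranspose_mul, hg, conjTranspose_one]
    have h1 : toHyperboloid p = ((k⁻¹ : ℝ) : ℂ) • (h * toHyperboloid q * hᴴ) := by
      have hk' : (k : ℂ) ≠ 0 := by exact_mod_cast hk.ne'
      rw [hkq, Matrix.mul_smul, Matrix.smul_mul, smul_smul, Complex.ofReal_inv,
        inv_mul_cancel₀ hk', one_smul]
      calc toHyperboloid p = (h * g) * toHyperboloid p * (gᴴ * hᴴ) := by
            rw [hg, hg', one_mul, mul_one]
        _ = _ := by simp only [Matrix.mul_assoc]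
    rw [h1, hs, Finset.mul_sum, Finset.sum_mul, Finset.smul_sum]
    refine Finset.sum_congr rfl fun i _ => ?_
    rw [lightVector_mulVec, Matrix.mul_smul, Matrix.smul_mul, smul_smul, Complex.ofReal_mul]
    congr 1
    calc h * (g * lightVector (v i) * gᴴ) * hᴴ = (h * g) * lightVector (v i) * (gᴴ * hᴴ) := by
          simp only [Matrix.mul_assoc]
      _ = _ := by rw [hg, hg', one_mul, mul_one]
  · rintro ⟨hp, c, hc, hs⟩
    obtain ⟨k, hk, hkq⟩ := hpq hp
    refine ⟨hU.2 hp, fun i => k * c i, fun i => mul_nonneg hk.le (hc i), ?_⟩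
    rw [hkq, hs, Finset.mul_sum, Finset.sum_mul, Finset.smul_sum]
    refine Finset.sum_congr rfl fun i _ => ?_
    rw [lightVector_mulVec, Matrix.mul_smul, Matrix.smul_mul, smul_smul, Complex.ofReal_mul]

theorem ofReal_norm_sq (w : ℂ) : ((‖w‖ : ℂ)) ^ 2 = w * (starRingEnd ℂ) w := by
  rw [Complex.mul_conj, Complex.normSq_eq_norm_sq, Complex.ofReal_pow]

theorem simplexVolume_affine (a b : ℂ) (ha : a ≠ 0) (v : Fin 4 → Fin 2 → ℂ) :
    simplexVolume (fun i => !![a, b; 0, 1] *ᵥ v i) = simplexVolume v := by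
  refine simplexVolume_eq_of_equiv _ (measurePreserving_similarityEquiv a b ha) fun p => ?_
  have ha' : 0 < ‖a‖ := norm_pos_iff.2 ha
  refine mem_idealSimplex_mulVec_iff _ !![a⁻¹, -a⁻¹ * b; 0, 1] ?_ v p _ ?_ fun hp => ?_
  · ext i j; fin_cases i <;> fin_cases j <;> simp [ha]
  · simp [upperHalfSpace, similarityEquiv_apply, ha']
  · have hp' : 0 < p.2 := hp
    refine ⟨‖a‖⁻¹, inv_pos.2 ha', ?_⟩
    have h1 : (p.2 : ℂ) ≠ 0 := by exact_mod_cast hp'.ne'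
    have h2 : (‖a‖ : ℂ) ≠ 0 := by exact_mod_cast ha'.ne'
    have h3 := ofReal_norm_sq p.1
    have h4 := ofReal_norm_sq (a * p.1 + b)
    have h5 := ofReal_norm_sq a
    simp only [map_add, map_mul] at h4
    ext i j
    fin_cases i <;> fin_cases j <;>
      simp [toHyperboloid, similarityEquiv_apply, Matrix.vecMul, dotProduct, Fin.sum_univ_two,
        mul_pow, h3, h4, h5] <;> (field_simp; try ring)

theorem simplexVolume_swap (v : Fin 4 → Fin 2 → ℂ) :
    simplexVolume (fun i => !![0, 1; 1, 0] *ᵥ v i) = simplexVolume v := by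
  refine simplexVolume_eq_of_equiv (inversionEquiv.trans conjEquiv)
    (measurePreserving_conjEquiv.comp measurePreserving_inversionEquiv) fun p => ?_
  refine mem_idealSimplex_mulVec_iff _ !![0, 1; 1, 0] ?_ v p _ ?_ fun hp => ?_
  · ext i j; fin_cases i <;> fin_cases j <;> simp
  · simp only [upperHalfSpace, Set.mem_ofPred_eq, MeasurableEquiv.trans_apply, conjEquiv_apply,
      inversionEquiv_apply, Prod.smul_snd, smul_eq_mul]
    constructor
    · intro h
      by_contra h'
      rw [not_lt] at h'
      have : (‖p.1‖ ^ 2 + p.2 ^ 2)⁻¹ * p.2 ≤ 0 :=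
        mul_nonpos_of_nonneg_of_nonpos (by positivity) h'
      linarith
    · intro h
      positivity
  · have hp' : 0 < p.2 := hp
    refine ⟨1, one_pos, ?_⟩
    have hA : 0 < ‖p.1‖ ^ 2 + p.2 ^ 2 := by positivity
    have h1 : (p.2 : ℂ) ≠ 0 := by exact_mod_cast hp'.ne'
    have h2 : (‖p.1‖ : ℂ) ^ 2 + (p.2 : ℂ) ^ 2 ≠ 0 := by exact_mod_cast hA.ne'
    have h3 : ‖(‖p.1‖ ^ 2 + p.2 ^ 2)⁻¹ • p.1‖ ^ 2 + ((‖p.1‖ ^ 2 + p.2 ^ 2)⁻¹ * p.2) ^ 2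
        = (‖p.1‖ ^ 2 + p.2 ^ 2)⁻¹ := by
      rw [norm_smul, Real.norm_eq_abs, mul_pow, sq_abs]
      field_simp
    simp only [toHyperboloid, MeasurableEquiv.trans_apply, conjEquiv_apply,
      inversionEquiv_apply, Prod.smul_snd, smul_eq_mul, Prod.smul_fst, RCLike.norm_conj, h3]
    ext i j
    fin_cases i <;> fin_cases j <;>
      simp [Matrix.vecMul, dotProduct, Fin.sum_univ_two] <;> field_simp

/-- Bruhat decomposition: `g` is upper triangular, or a translation times the swap times an upper
triangular matrix. -/
theorem simplexVolume_mulVec (g : Matrix (Fin 2) (Fin 2) ℂ) (hg : g.det ≠ 0)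
    (v : Fin 4 → Fin 2 → ℂ) : simplexVolume (fun i => g *ᵥ v i) = simplexVolume v := by
  have upper : ∀ (a b d : ℂ), a ≠ 0 → d ≠ 0 → ∀ v : Fin 4 → Fin 2 → ℂ,
      simplexVolume (fun i => !![a, b; 0, d] *ᵥ v i) = simplexVolume v := by
    intro a b d ha hd v
    refine Eq.trans ?_ ((simplexVolume_smul _ (fun _ => d) (fun _ => hd)).trans
      (simplexVolume_affine (a / d) (b / d) (div_ne_zero ha hd) v))
    congr 1
    funext i j
    fin_cases j <;> simp [Matrix.mulVec, dotProduct, Fin.sum_univ_two] <;> field_simp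
  rw [Matrix.det_fin_two] at hg
  rcases eq_or_ne (g 1 0) 0 with h | h
  · rw [h, mul_zero, sub_zero] at hg
    rw [← upper (g 0 0) (g 0 1) (g 1 1) (left_ne_zero_of_mul hg) (right_ne_zero_of_mul hg) v]
    congr 1
    funext i
    rw [Matrix.eta_fin_two g]
    simp [h]
  · have he : g 0 1 - g 0 0 * g 1 1 / g 1 0 ≠ 0 := by
      intro h'
      apply hg
      field_simp at h'
      linear_combination -h'
    refine Eq.trans ?_ ((simplexVolume_affine 1 (g 0 0 / g 1 0) one_ne_zero _).trans
      ((simplexVolume_swap _).trans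
        (upper (g 1 0) (g 1 1) (g 0 1 - g 0 0 * g 1 1 / g 1 0) h he v)))
    congr 1
    funext i
    rw [Matrix.mulVec_mulVec, Matrix.mulVec_mulVec]
    congr 1
    ext j k
    fin_cases j <;> fin_cases k <;> simp [Matrix.mul_apply, Fin.sum_univ_two, h]
    ring

theorem simplexVolume_conj (v : Fin 4 → Fin 2 → ℂ) :
    simplexVolume (fun i => star (v i)) = simplexVolume v := by
  refine simplexVolume_eq_of_equiv _ measurePreserving_conjEquiv fun p => ?_
  have hl : ∀ w : Fin 2 → ℂ, lightVector (star w) = (lightVector w).map (starRingEnd ℂ) := by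
    intro w
    ext i j
    simp [lightVector, vecMulVec_apply]
  have hH : toHyperboloid (conjEquiv p) = (toHyperboloid p).map (starRingEnd ℂ) := by
    ext i j
    fin_cases i <;> fin_cases j <;> simp [toHyperboloid, conjEquiv_apply]
  have hsum : ∀ c : Fin 4 → ℝ, ∑ i, (c i : ℂ) • lightVector (star (v i)) =
      (∑ i, (c i : ℂ) • lightVector (v i)).map (starRingEnd ℂ) := by
    intro c
    ext i j
    simp [hl, Matrix.sum_apply]
  have hinj : Function.Injective
      (fun M : Matrix (Fin 2) (Fin 2) ℂ => M.map (starRingEnd ℂ)) :=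
    Matrix.map_injective (starRingEnd ℂ).injective
  simp only [idealSimplex, Set.mem_ofPred_eq, hH, hsum]
  refine and_congr Iff.rfl (exists_congr fun c => and_congr Iff.rfl ?_)
  exact hinj.eq_iff

end

section

open MeasureTheory Real

/-! ## The integral of `-log sin` -/

/-- The primitive of `-log sin` vanishing at `0`; up to a linear term, it is the Lobachevsky
function. -/
def logSinPrimitive (x : ℝ) : ℝ := -∫ t in (0 : ℝ)..x, log (sin t)

theorem intervalIntegrable_log_sin' (a b : ℝ) :
    IntervalIntegrable (fun t => log (sin t)) volume a b :=
  intervalIntegrable_log_sin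

theorem integral_log_sin_eq (a b : ℝ) :
    ∫ t in a..b, log (sin t) = logSinPrimitive a - logSinPrimitive b := by
  have := intervalIntegral.integral_interval_sub_left
    (intervalIntegrable_log_sin' 0 b) (intervalIntegrable_log_sin' 0 a)
  rw [logSinPrimitive, logSinPrimitive, ← this]
  ring

theorem logSinPrimitive_pi_sub (x : ℝ) :
    logSinPrimitive (π - x) = logSinPrimitive π - logSinPrimitive x := by
  have h : ∫ t in (π - x)..π, log (sin t) = ∫ t in (0 : ℝ)..x, log (sin t) := by
    have := intervalIntegral.integral_comp_sub_left (a := 0) (b := x) (fun t => log (sin t)) π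
    simp only [sin_pi_sub, sub_zero] at this
    exact this.symm
  rw [integral_log_sin_eq, integral_log_sin_eq] at h
  have h0 : logSinPrimitive 0 = 0 := by simp [logSinPrimitive]
  linarith

/-- The derivative of the sum at `t` is `log sin (c - t) - log sin t`, positive for `t < c / 2`
because `sin (c - t) - sin t = 2 sin (c / 2 - t) cos (c / 2)` and `c < π`. -/
theorem logSinPrimitive_add_lt_of_le {a b c : ℝ} (ha : 0 < a) (hab : a < b) (hbc : b ≤ c / 2)
    (hc : c < π) :
    logSinPrimitive a + logSinPrimitive (c - a) < logSinPrimitive b + logSinPrimitive (c - b) := by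
  have h1 : ∫ t in a..b, log (sin (c - t)) = logSinPrimitive (c - b) - logSinPrimitive (c - a) := by
    rw [intervalIntegral.integral_comp_sub_left (fun t => log (sin t)) c, integral_log_sin_eq]
  have hi1 : IntervalIntegrable (fun t => log (sin (c - t))) volume a b := by
    have := (intervalIntegrable_log_sin' (c - a) (c - b)).comp_sub_left c
    simpa using this
  have h2 := integral_log_sin_eq a b
  have hpos : 0 < ∫ t in a..b, (log (sin (c - t)) - log (sin t)) := by
    refine intervalIntegral.intervalIntegral_pos_of_pos_on
      (hi1.sub (intervalIntegrable_log_sin' a b)) (fun t ht => ?_) hab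
    have hs : 0 < sin t := sin_pos_of_pos_of_lt_pi (by linarith [ht.1]) (by linarith [ht.2])
    refine sub_pos.2 (log_lt_log hs ?_)
    rw [← sub_pos, sin_sub_sin]
    refine mul_pos (mul_pos two_pos (sin_pos_of_pos_of_lt_pi ?_ ?_)) (cos_pos_of_mem_Ioo ⟨?_, ?_⟩)
    all_goals linarith [ht.1, ht.2]
  rw [intervalIntegral.integral_sub hi1 (intervalIntegrable_log_sin' a b)] at hpos
  linarith

theorem logSinPrimitive_add_lt {a b c : ℝ} (ha : 0 < a) (hab : a < b) (hbc : b < c - a)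
    (hc : c < π) :
    logSinPrimitive a + logSinPrimitive (c - a) < logSinPrimitive b + logSinPrimitive (c - b) := by
  rcases le_total b (c / 2) with h | h
  · exact logSinPrimitive_add_lt_of_le ha hab h hc
  · have := logSinPrimitive_add_lt_of_le (b := c - b) ha (by linarith) (by linarith) hc
    rw [sub_sub_cancel] at this
    linarith

/-- The volume of the ideal tetrahedron with dihedral angles `a, b, c`. -/
def angleVolume (a b c : ℝ) : ℝ :=
  logSinPrimitive a + logSinPrimitive b + logSinPrimitive c - logSinPrimitive π

theorem angleVolume_lt_of_le {a b c : ℝ} (ha : 0 < a) (hab : a ≤ b) (hbc : b ≤ c)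
    (h : a + b + c = π) (hne : a ≠ π / 3) :
    angleVolume a b c < angleVolume (π / 3) (π / 3) (π / 3) := by
  have ha' : a < π / 3 := lt_of_le_of_ne (by linarith) hne
  -- Two smoothing moves at constant sum: `(a, c)` becomes `(π / 3, a + c - π / 3)`, then the two
  -- angles other than `π / 3` are equalised.
  have h1 := logSinPrimitive_add_lt (a := a) (b := π / 3) (c := a + c) ha ha'
    (by linarith) (by linarith)
  have h2 : logSinPrimitive b + logSinPrimitive (a + c - π / 3) ≤
      logSinPrimitive (π / 3) + logSinPrimitive (π / 3) := by
    rcases lt_trichotomy b (π / 3) with hb | hb | hb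
    · have := logSinPrimitive_add_lt (a := b) (b := π / 3) (c := 2 * π / 3) (by linarith) hb
        (by linarith) (by linarith [pi_pos])
      rw [show 2 * π / 3 - π / 3 = π / 3 by ring, show 2 * π / 3 - b = a + c - π / 3 by linarith]
        at this
      exact this.le
    · rw [show a + c - π / 3 = π / 3 by linarith, hb]
    · have := logSinPrimitive_add_lt (a := a + c - π / 3) (b := π / 3) (c := 2 * π / 3)
        (by linarith) (by linarith) (by linarith) (by linarith [pi_pos])
      rw [show 2 * π / 3 - π / 3 = π / 3 by ring,
        show 2 * π / 3 - (a + c - π / 3) = b by linarith] at this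
      linarith
  rw [show a + c - a = c by ring] at h1
  unfold angleVolume
  linarith

theorem angleVolume_lt {a b c : ℝ} (ha : 0 < a) (hb : 0 < b) (hc : 0 < c)
    (h : a + b + c = π) (hne : ¬ (a = π / 3 ∧ b = π / 3)) :
    angleVolume a b c < angleVolume (π / 3) (π / 3) (π / 3) := by
  have key : ∀ x y z : ℝ, 0 < x → x ≤ y → y ≤ z → x + y + z = π →
      angleVolume x y z = angleVolume a b c → ¬ (x = π / 3 ∧ y = π / 3 ∧ z = π / 3) →
      angleVolume a b c < angleVolume (π / 3) (π / 3) (π / 3) := by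
    intro x y z hx hxy hyz hs he hn
    rw [← he]
    refine angleVolume_lt_of_le hx hxy hyz hs fun hx' => hn ⟨hx', ?_, ?_⟩ <;> linarith
  have hn : ¬ (a = π / 3 ∧ b = π / 3 ∧ c = π / 3) := fun h => hne ⟨h.1, h.2.1⟩
  rcases le_total a b with h1 | h1 <;> rcases le_total b c with h2 | h2 <;>
    rcases le_total a c with h3 | h3
  · exact key a b c ha h1 h2 h rfl hn
  · exact key a b c ha h1 h2 h rfl hn
  · exact key a c b ha h3 h2 (by linarith) (by unfold angleVolume; ring) (by tauto)
  · exact key c a b hc h3 h1 (by linarith) (by unfold angleVolume; ring) (by tauto)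
  · exact key b a c hb h1 h3 (by linarith) (by unfold angleVolume; ring) (by tauto)
  · exact key b c a hb h2 h3 (by linarith) (by unfold angleVolume; ring) (by tauto)
  · exact key c b a hc h2 h1 (by linarith) (by unfold angleVolume; ring) (by tauto)
  · exact key c b a hc h2 h1 (by linarith) (by unfold angleVolume; ring) (by tauto)

theorem intervalIntegrable_half_log_sin {a b c : ℝ} :
    IntervalIntegrable (fun t => (log (sin (t + b)) + log (sin (t + c)) -
      log (sin t) - log (sin (a - t))) / 2) volume 0 a := by
  have h1 : ∀ d : ℝ, IntervalIntegrable (fun t => log (sin (t + d))) volume 0 a := fun d => by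
    have := (intervalIntegrable_log_sin' (0 + d) (a + d)).comp_add_right d
    simpa using this
  have h2 : IntervalIntegrable (fun t => log (sin (a - t))) volume 0 a := by
    have := (intervalIntegrable_log_sin' (a - 0) (a - a)).comp_sub_left a
    simpa using this
  exact ((((h1 b).add (h1 c)).sub (intervalIntegrable_log_sin' 0 a)).sub h2).div_const 2

/-- The integrand is the angular density of the volume seen from the vertex `0` of the triangle. The
shifted integrals run over `[b, π - c]` and `[c, π - b]`, where the reflection formula applies. -/
theorem integral_half_log_sin {a b c : ℝ} (h : a + b + c = π) :
    ∫ t in (0 : ℝ)..a, (log (sin (t + b)) + log (sin (t + c)) -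
      log (sin t) - log (sin (a - t))) / 2 = angleVolume a b c := by
  have h1 : ∀ d : ℝ, IntervalIntegrable (fun t => log (sin (t + d))) volume 0 a := fun d => by
    have := (intervalIntegrable_log_sin' (0 + d) (a + d)).comp_add_right d
    simpa using this
  have h2 : IntervalIntegrable (fun t => log (sin (a - t))) volume 0 a := by
    have := (intervalIntegrable_log_sin' (a - 0) (a - a)).comp_sub_left a
    simpa using this
  have h0 : logSinPrimitive 0 = 0 := by simp [logSinPrimitive]
  rw [intervalIntegral.integral_div,
    intervalIntegral.integral_sub (((h1 b).add (h1 c)).sub (intervalIntegrable_log_sin' 0 a)) h2,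
    intervalIntegral.integral_sub ((h1 b).add (h1 c)) (intervalIntegrable_log_sin' 0 a),
    intervalIntegral.integral_add (h1 b) (h1 c),
    intervalIntegral.integral_comp_add_right (fun t => log (sin t)),
    intervalIntegral.integral_comp_add_right (fun t => log (sin t)),
    intervalIntegral.integral_comp_sub_left (fun t => log (sin t)),
    integral_log_sin_eq, integral_log_sin_eq, integral_log_sin_eq, integral_log_sin_eq,
    show a + b = π - c by linarith, show a + c = π - b by linarith, logSinPrimitive_pi_sub,
    logSinPrimitive_pi_sub, sub_self, sub_zero, zero_add, zero_add, h0]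
  unfold angleVolume
  ring

end

section

open MeasureTheory Real

/-! ## The volume of the ideal simplex with vertices `∞, 0, 1, z` -/

/-- Representatives of the ideal points `∞, 0, 1, z`. -/
def standardVertices (z : ℂ) : Fin 4 → Fin 2 → ℂ := ![![1, 0], ![0, 1], ![1, 1], ![z, 1]]

theorem toHyperboloid_eq_sum_standard_iff (z : ℂ) (p : ℂ × ℝ) (c : Fin 4 → ℝ) :
    toHyperboloid p = ∑ i, (c i : ℂ) • lightVector (standardVertices z i) ↔
      p.2⁻¹ * (‖p.1‖ ^ 2 + p.2 ^ 2) = c 0 + c 2 + c 3 * ‖z‖ ^ 2 ∧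
      p.2⁻¹ * p.1.re = c 2 + c 3 * z.re ∧ p.2⁻¹ * p.1.im = c 3 * z.im ∧
      p.2⁻¹ = c 1 + c 2 + c 3 := by
  have hzz : z * (starRingEnd ℂ) z = ((‖z‖ ^ 2 : ℝ) : ℂ) := by
    rw [Complex.mul_conj, Complex.normSq_eq_norm_sq]
  have hS : ∑ i, (c i : ℂ) • lightVector (standardVertices z i) =
      !![((c 0 + c 2 + c 3 * ‖z‖ ^ 2 : ℝ) : ℂ), c 2 + c 3 * z;
        c 2 + c 3 * (starRingEnd ℂ) z, ((c 1 + c 2 + c 3 : ℝ) : ℂ)] := by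
    ext i j
    fin_cases i <;> fin_cases j <;>
      simp [Matrix.sum_apply, Fin.sum_univ_four, lightVector_apply, standardVertices, hzz]
  rw [hS, toHyperboloid, ← Matrix.ext_iff]
  simp only [Fin.forall_fin_two, Matrix.smul_apply, smul_eq_mul, Matrix.of_apply,
    Matrix.cons_val_zero, Matrix.cons_val_one, Matrix.cons_val_fin_one]
  constructor
  · rintro ⟨⟨h1, h2⟩, h3, h4⟩
    refine ⟨by exact_mod_cast h1, ?_, ?_, ?_⟩
    · simpa using congrArg Complex.re h2
    · simpa using congrArg Complex.im h2
    · simpa using congrArg Complex.re h4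
  · rintro ⟨h1, h2, h3, h4⟩
    refine ⟨⟨by exact_mod_cast h1, ?_⟩, ?_, ?_⟩
    · apply Complex.ext <;> simp [h2, h3]
    · apply Complex.ext
      · simp [h2]
      · simp [← h3]
    · rw [h4]; simp

/-- The ideal simplex with vertices `∞, 0, 1, z` lies above the triangle `0, 1, z`, outside of the
hemisphere through these points. -/
theorem mem_idealSimplex_standard_iff (z : ℂ) (hz : 0 < z.im) (p : ℂ × ℝ) :
    p ∈ idealSimplex (standardVertices z) ↔ 0 < p.2 ∧ 0 ≤ p.1.im ∧
      p.1.im * z.re ≤ p.1.re * z.im ∧ p.1.re * z.im + p.1.im * (1 - z.re) ≤ z.im ∧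
      p.1.re * z.im + p.1.im * (‖z‖ ^ 2 - z.re) ≤ (‖p.1‖ ^ 2 + p.2 ^ 2) * z.im := by
  constructor
  · rintro ⟨hp, c, hc, h⟩
    have hp' : 0 < p.2 := hp
    rw [toHyperboloid_eq_sum_standard_iff z p] at h
    obtain ⟨h1, h2, h3, h4⟩ := h
    have e1 : ‖p.1‖ ^ 2 + p.2 ^ 2 = p.2 * (c 0 + c 2 + c 3 * ‖z‖ ^ 2) := by
      rw [← h1]; field_simp
    have e2 : p.1.re = p.2 * (c 2 + c 3 * z.re) := by rw [← h2]; field_simp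
    have e3 : p.1.im = p.2 * (c 3 * z.im) := by rw [← h3]; field_simp
    have e4 : 1 = p.2 * (c 1 + c 2 + c 3) := by rw [← h4]; field_simp
    have k0 := mul_nonneg (mul_nonneg hp'.le (hc 0)) hz.le
    have k1 := mul_nonneg (mul_nonneg hp'.le (hc 1)) hz.le
    have k2 := mul_nonneg (mul_nonneg hp'.le (hc 2)) hz.le
    have k3 := mul_nonneg (mul_nonneg hp'.le (hc 3)) hz.le
    refine ⟨hp', ?_, ?_, ?_, ?_⟩
    · rw [e3]; linarith
    · rw [e2, e3]; linarith
    · rw [e2, e3]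
      have := congrArg (· * z.im) e4
      simp only [one_mul] at this
      linarith
    · rw [e1, e2, e3]
      linarith
  · rintro ⟨hp, h3, h2, h1, h0⟩
    have hz' := hz.ne'
    -- The coefficients solve the linear system of `toHyperboloid_eq_sum_standard_iff`, from `c 3`
    -- up to `c 0`; each inequality is the sign of one of them.
    refine ⟨hp, ![p.2⁻¹ * (‖p.1‖ ^ 2 + p.2 ^ 2 -
      (p.1.re * z.im + p.1.im * (‖z‖ ^ 2 - z.re)) / z.im),
      p.2⁻¹ * (1 - (p.1.re * z.im + p.1.im * (1 - z.re)) / z.im),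
      p.2⁻¹ * ((p.1.re * z.im - p.1.im * z.re) / z.im),
      p.2⁻¹ * (p.1.im / z.im)], ?_, ?_⟩
    · intro i
      have hi : 0 ≤ p.2⁻¹ := (inv_pos.2 hp).le
      fin_cases i
      · exact mul_nonneg hi (sub_nonneg.2 ((div_le_iff₀ hz).2 h0))
      · exact mul_nonneg hi (sub_nonneg.2 ((div_le_iff₀ hz).2 (by linarith)))
      · exact mul_nonneg hi (div_nonneg (by linarith) hz.le)
      · exact mul_nonneg hi (div_nonneg h3 hz.le)
    · rw [toHyperboloid_eq_sum_standard_iff z p]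
      have hp' := hp.ne'
      simp only [Matrix.cons_val]
      refine ⟨?_, ?_, ?_, ?_⟩ <;> field_simp <;> ring

theorem lintegral_inv_pow_three (q : ℝ) (hq : 0 < q) :
    ∫⁻ t : ℝ, {t : ℝ | 0 < t ∧ q ≤ t ^ 2}.indicator (fun t => ENNReal.ofReal ((t ^ 3)⁻¹)) t =
      ENNReal.ofReal ((2 * q)⁻¹) := by
  have hs : {t : ℝ | 0 < t ∧ q ≤ t ^ 2} = Set.Ici (√q) := by
    ext t
    simp only [Set.mem_ofPred_eq, Set.mem_Ici]
    constructor
    · rintro ⟨h1, h2⟩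
      exact (sqrt_le_left h1.le).2 h2
    · intro h
      have h0 := sqrt_pos.2 hq
      exact ⟨h0.trans_le h, (sqrt_le_left (h0.le.trans h)).1 h⟩
  have h0 := sqrt_pos.2 hq
  rw [hs, lintegral_indicator measurableSet_Ici, ← restrict_Ioi_eq_restrict_Ici]
  have hcongr : ∀ t ∈ Set.Ioi (√q), ENNReal.ofReal ((t ^ 3)⁻¹) =
      ENNReal.ofReal (t ^ (-3 : ℝ)) := fun t ht => by
    have : 0 < t := h0.trans ht
    rw [rpow_neg this.le]
    norm_cast
  rw [setLIntegral_congr_fun measurableSet_Ioi hcongr, ← ofReal_integral_eq_lintegral_ofReal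
    (integrableOn_Ioi_rpow_of_lt (by norm_num) h0), integral_Ioi_rpow_of_lt (by norm_num) h0]
  · congr 1
    rw [show (-3 : ℝ) + 1 = -2 by norm_num, rpow_neg h0.le]
    have : √q ^ (2 : ℝ) = q := by
      rw [show (2 : ℝ) = ((2 : ℕ) : ℝ) by norm_num, rpow_natCast, sq_sqrt hq.le]
    rw [this]
    field_simp
  · filter_upwards [ae_restrict_mem measurableSet_Ioi] with t ht
    exact rpow_nonneg (h0.trans ht).le _

theorem lintegral_inv_sub {l d : ℝ} (hl : 0 < l) (hd : l < d) :
    ∫⁻ r in Set.Ioc 0 l, ENNReal.ofReal ((2 * (d - r))⁻¹) =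
      ENNReal.ofReal ((log d - log (d - l)) / 2) := by
  have hcont : ContinuousOn (fun r : ℝ => (2 * (d - r))⁻¹) (Set.uIcc 0 l) := by
    refine ContinuousOn.inv₀ (by fun_prop) fun r hr => ?_
    rw [Set.uIcc_of_le hl.le] at hr
    have : r < d := hr.2.trans_lt hd
    exact (mul_pos two_pos (sub_pos.2 this)).ne'
  have hint := hcont.intervalIntegrable (μ := volume)
  rw [← ofReal_integral_eq_lintegral_ofReal hint.1, ← intervalIntegral.integral_of_le hl.le]
  · congr 1
    have : ∀ r ∈ Set.uIcc 0 l, HasDerivAt (fun r => -log (d - r) / 2) ((2 * (d - r))⁻¹) r := by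
      intro r hr
      rw [Set.uIcc_of_le hl.le] at hr
      have h : 0 < d - r := sub_pos.2 (hr.2.trans_lt hd)
      have := ((((hasDerivAt_id r).const_sub d).log h.ne').neg).div_const 2
      refine this.congr_deriv ?_
      simp only [id]
      field_simp
    rw [intervalIntegral.integral_eq_sub_of_hasDerivAt this hint]
    simp only [sub_zero]
    ring
  · filter_upwards [ae_restrict_mem measurableSet_Ioc] with r hr
    have : 0 < d - r := sub_pos.2 (hr.2.trans_lt hd)
    change 0 ≤ (2 * (d - r))⁻¹
    positivity

end

/-! ### Integration in polar coordinates over a triangle with given angles -/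

section

open MeasureTheory Real

/-- The third vertex of the triangle with vertices `0, 1, z` and angles `a, b, c`. -/
def thirdVertex (a b c : ℝ) : ℂ := ((sin b / sin c : ℝ) : ℂ) * (cos a + sin a * Complex.I)

theorem thirdVertex_re (a b c : ℝ) : (thirdVertex a b c).re = sin b / sin c * cos a := by
  simp [thirdVertex, Complex.mul_re, -Complex.ofReal_cos, -Complex.ofReal_sin]

theorem thirdVertex_im (a b c : ℝ) : (thirdVertex a b c).im = sin b / sin c * sin a := by
  simp [thirdVertex, Complex.mul_im, -Complex.ofReal_cos, -Complex.ofReal_sin]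

theorem norm_thirdVertex_sq (a b c : ℝ) : ‖thirdVertex a b c‖ ^ 2 = (sin b / sin c) ^ 2 := by
  rw [← Complex.normSq_eq_norm_sq, Complex.normSq_apply, thirdVertex_re, thirdVertex_im]
  linear_combination (sin b / sin c) ^ 2 * sin_sq_add_cos_sq a

section

variable {a b c : ℝ}

theorem thirdVertex_im_pos (ha : 0 < a) (hb : 0 < b) (hc : 0 < c) (h : a + b + c = π) :
    0 < (thirdVertex a b c).im := by
  have sa : 0 < sin a := sin_pos_of_pos_of_lt_pi ha (by linarith)
  have sb : 0 < sin b := sin_pos_of_pos_of_lt_pi hb (by linarith)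
  have sc : 0 < sin c := sin_pos_of_pos_of_lt_pi hc (by linarith)
  rw [thirdVertex_im]
  positivity

/-- Seen from `0`, the ray at angle `f` leaves the triangle at distance `sin b / sin (f + b)` (law
of sines) and the circumscribed circle at distance `d = sin (f + c) / sin c`. Lying outside the
hemisphere means `r (d - r) ≤ t²`. -/
theorem mem_idealSimplex_polar_iff (ha : 0 < a) (hb : 0 < b) (hc : 0 < c) (h : a + b + c = π)
    {r f : ℝ} (t : ℝ) (hr : 0 < r) (hf : f ∈ Set.Ioo (-π) π) :
    ((Complex.polarCoord.symm (r, f), t) : ℂ × ℝ) ∈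
      idealSimplex (standardVertices (thirdVertex a b c)) ↔
      (f ∈ Set.Icc 0 a ∧ r ≤ sin b / sin (f + b)) ∧
        0 < t ∧ r * (sin (f + c) / sin c - r) ≤ t ^ 2 := by
  have sa : 0 < sin a := sin_pos_of_pos_of_lt_pi ha (by linarith)
  have sb : 0 < sin b := sin_pos_of_pos_of_lt_pi hb (by linarith)
  have sc : 0 < sin c := sin_pos_of_pos_of_lt_pi hc (by linarith)
  have hsc : sin c = sin a * cos b + cos a * sin b := by
    rw [← sin_add, show a + b = π - c by linarith, sin_pi_sub]
  have hsb : sin b = sin a * cos c + cos a * sin c := by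
    rw [← sin_add, show a + c = π - b by linarith, sin_pi_sub]
  rw [mem_idealSimplex_standard_iff _ (thirdVertex_im_pos ha hb hc h)]
  have hre : (Complex.polarCoord.symm (r, f)).re = r * cos f := by
    simp [Complex.mul_re, -Complex.ofReal_cos, -Complex.ofReal_sin]
  have him : (Complex.polarCoord.symm (r, f)).im = r * sin f := by
    simp [Complex.mul_im, -Complex.ofReal_cos, -Complex.ofReal_sin]
  have hn : ‖Complex.polarCoord.symm (r, f)‖ ^ 2 = r ^ 2 := by
    rw [Complex.norm_polarCoord_symm, sq_abs]
  simp only [hre, him, hn, norm_thirdVertex_sq, thirdVertex_im, thirdVertex_re]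
  have k : 0 < sin b / sin c := div_pos sb sc
  have i1 : 0 ≤ r * sin f ↔ 0 ≤ f := by
    rw [mul_nonneg_iff_of_pos_left hr]
    constructor
    · intro h1
      by_contra h2
      exact absurd (sin_neg_of_neg_of_neg_pi_lt (not_le.1 h2) hf.1) (not_lt.2 h1)
    · exact fun h1 => sin_nonneg_of_nonneg_of_le_pi h1 hf.2.le
  have i2 : 0 ≤ f → (r * sin f * (sin b / sin c * cos a) ≤ r * cos f * (sin b / sin c * sin a) ↔
      f ≤ a) := by
    intro h0
    rw [← sub_nonneg, show r * cos f * (sin b / sin c * sin a) - r * sin f *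
      (sin b / sin c * cos a) = r * (sin b / sin c) * sin (a - f) by rw [sin_sub]; ring,
      mul_nonneg_iff_of_pos_left (mul_pos hr k)]
    constructor
    · intro h1
      by_contra h2
      exact absurd (sin_neg_of_neg_of_neg_pi_lt (x := a - f) (by linarith) (by linarith [hf.2]))
        (not_lt.2 h1)
    · exact fun h1 => sin_nonneg_of_nonneg_of_le_pi (by linarith) (by linarith)
  have i3 : 0 ≤ f → f ≤ a → (r * cos f * (sin b / sin c * sin a) + r * sin f *
      (1 - sin b / sin c * cos a) ≤ sin b / sin c * sin a ↔ r ≤ sin b / sin (f + b)) := by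
    intro h0 h1
    have sfb : 0 < sin (f + b) := sin_pos_of_pos_of_lt_pi (by linarith) (by linarith)
    rw [le_div_iff₀ sfb, ← sub_nonneg, show sin b / sin c * sin a - (r * cos f *
      (sin b / sin c * sin a) + r * sin f * (1 - sin b / sin c * cos a)) =
      (sin a / sin c) * (sin b - r * sin (f + b)) by
        rw [sin_add]; field_simp; linear_combination (-r * sin f) * hsc,
      mul_nonneg_iff_of_pos_left (div_pos sa sc), sub_nonneg]
  have i4 : r * cos f * (sin b / sin c * sin a) + r * sin f *
      ((sin b / sin c) ^ 2 - sin b / sin c * cos a) ≤ (r ^ 2 + t ^ 2) * (sin b / sin c * sin a) ↔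
      r * (sin (f + c) / sin c - r) ≤ t ^ 2 := by
    rw [← sub_nonneg, show (r ^ 2 + t ^ 2) * (sin b / sin c * sin a) - (r * cos f *
      (sin b / sin c * sin a) + r * sin f * ((sin b / sin c) ^ 2 - sin b / sin c * cos a)) =
      (sin b / sin c * sin a) * (t ^ 2 - r * (sin (f + c) / sin c - r)) by
        rw [sin_add]; field_simp; linear_combination (-r * sin f) * hsb,
      mul_nonneg_iff_of_pos_left (mul_pos k sa), sub_nonneg]
  rw [i1, i4]
  constructor
  · rintro ⟨ht, h0, h1, h2, h3⟩
    have h1 := (i2 h0).1 h1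
    exact ⟨⟨⟨h0, h1⟩, (i3 h0 h1).1 h2⟩, ht, h3⟩
  · rintro ⟨⟨⟨h0, h1⟩, h2⟩, ht, h3⟩
    exact ⟨ht, h0, (i2 h0).2 h1, (i3 h0 h1).2 h2, h3⟩

theorem measurableSet_idealSimplex_standard {z : ℂ} (hz : 0 < z.im) :
    MeasurableSet (idealSimplex (standardVertices z)) := by
  have : idealSimplex (standardVertices z) = {p : ℂ × ℝ | 0 < p.2} ∩ ({p | 0 ≤ p.1.im} ∩
      ({p | p.1.im * z.re ≤ p.1.re * z.im} ∩
      ({p | p.1.re * z.im + p.1.im * (1 - z.re) ≤ z.im} ∩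
      {p | p.1.re * z.im + p.1.im * (‖z‖ ^ 2 - z.re) ≤ (‖p.1‖ ^ 2 + p.2 ^ 2) * z.im}))) := by
    ext p
    exact mem_idealSimplex_standard_iff z hz p
  rw [this]
  have hre : Measurable fun p : ℂ × ℝ => p.1.re := Complex.measurable_re.comp measurable_fst
  have him : Measurable fun p : ℂ × ℝ => p.1.im := Complex.measurable_im.comp measurable_fst
  refine (measurableSet_lt measurable_const measurable_snd).inter
    ((measurableSet_le measurable_const him).inter ((measurableSet_le (by fun_prop)
    (by fun_prop)).inter ((measurableSet_le (by fun_prop) (by fun_prop)).inter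
    (measurableSet_le (by fun_prop) (by fun_prop)))))

/-- The density of the projection of the hyperbolic measure on `s` to `ℂ`. -/
def fiberVolume (s : Set (ℂ × ℝ)) (w : ℂ) : ENNReal :=
  ∫⁻ t : ℝ, s.indicator (fun p => ENNReal.ofReal ((p.2 ^ 3)⁻¹)) (w, t)

theorem hyperbolicVolume_eq_lintegral_polar {s : Set (ℂ × ℝ)} (hs : MeasurableSet s)
    (hsU : s ⊆ upperHalfSpace) :
    hyperbolicVolume s = ∫⁻ f in Set.Ioo (-π) π, ∫⁻ r in Set.Ioi (0 : ℝ),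
      ENNReal.ofReal r * fiberVolume s (Complex.polarCoord.symm (r, f)) := by
  have hm : Measurable (s.indicator fun p : ℂ × ℝ => ENNReal.ofReal ((p.2 ^ 3)⁻¹)) :=
    Measurable.indicator (by fun_prop) hs
  have hfib : Measurable (fiberVolume s) := hm.lintegral_prod_right'
  have hpol : Measurable fun p : ℝ × ℝ => Complex.polarCoord.symm p := by
    simp only [Complex.polarCoord_symm_apply]
    fun_prop
  rw [hyperbolicVolume_apply _ hs, Set.inter_eq_left.2 hsU, ← lintegral_indicator hs,
    Measure.volume_eq_prod, lintegral_prod _ hm.aemeasurable]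
  change ∫⁻ w, fiberVolume s w = _
  rw [← Complex.lintegral_comp_polarCoord_symm, polarCoord_target, Measure.volume_eq_prod,
    ← Measure.prod_restrict, lintegral_prod_symm]
  · simp only [smul_eq_mul]
  · exact (Measurable.mul (by fun_prop) (hfib.comp hpol)).aemeasurable

/-- All of it rests on `sin (f + c) sin (f + b) - sin b sin c = sin f sin (a - f)`: inside the
angle, the opposite side lies strictly within the circle. -/
theorem radius_bounds (ha : 0 < a) (hb : 0 < b) (hc : 0 < c) (h : a + b + c = π) {f : ℝ}
    (hf : f ∈ Set.Ioo 0 a) :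
    0 < sin b / sin (f + b) ∧ sin b / sin (f + b) < sin (f + c) / sin c ∧
      log (sin (f + c) / sin c) - log (sin (f + c) / sin c - sin b / sin (f + b)) =
        log (sin (f + b)) + log (sin (f + c)) - log (sin f) - log (sin (a - f)) := by
  have sb : 0 < sin b := sin_pos_of_pos_of_lt_pi hb (by linarith)
  have sc : 0 < sin c := sin_pos_of_pos_of_lt_pi hc (by linarith)
  have sfb : 0 < sin (f + b) :=
    sin_pos_of_pos_of_lt_pi (by linarith [hf.1]) (by linarith [hf.2])
  have sfc : 0 < sin (f + c) :=
    sin_pos_of_pos_of_lt_pi (by linarith [hf.1]) (by linarith [hf.2])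
  have sf : 0 < sin f := sin_pos_of_pos_of_lt_pi hf.1 (by linarith [hf.2])
  have saf : 0 < sin (a - f) :=
    sin_pos_of_pos_of_lt_pi (by linarith [hf.2]) (by linarith [hf.1])
  have hdl : sin (f + c) / sin c - sin b / sin (f + b) =
      sin f * sin (a - f) / (sin c * sin (f + b)) := by
    have e : sin (f + c) * sin (f + b) - sin b * sin c = sin f * sin (a - f) := by
      rw [show a - f = π - (f + b + c) by linarith, sin_pi_sub, sin_add (f + b), sin_add,
        sin_add, cos_add]
      linear_combination (sin b * sin c) * sin_sq_add_cos_sq f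
    field_simp
    linear_combination e
  have hl : 0 < sin b / sin (f + b) := div_pos sb sfb
  have hd : sin b / sin (f + b) < sin (f + c) / sin c := by
    rw [← sub_pos, hdl]
    positivity
  refine ⟨hl, hd, ?_⟩
  rw [hdl, log_div sfc.ne' sc.ne', log_div (by positivity) (by positivity),
    log_mul sf.ne' saf.ne', log_mul sc.ne' sfb.ne']
  ring

theorem angleVolume_nonneg (ha : 0 < a) (hb : 0 < b) (hc : 0 < c) (h : a + b + c = π) :
    0 ≤ angleVolume a b c := by
  rw [← integral_half_log_sin h, intervalIntegral.integral_of_le ha.le,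
    ← restrict_Ioo_eq_restrict_Ioc]
  refine setIntegral_nonneg measurableSet_Ioo fun f hf => ?_
  obtain ⟨hl, hd, hlog⟩ := radius_bounds ha hb hc h hf
  rw [← hlog]
  exact div_nonneg (sub_nonneg.2 (log_le_log (sub_pos.2 hd) (by linarith))) two_pos.le

/-- Integrating out `t` leaves `1 / (2 (d - r))` once the polar factor `r` is included; integrating
out `r` leaves half a logarithm, which `radius_bounds` splits into log-sines; the integral over `f`
is `integral_half_log_sin`. -/
theorem hyperbolicVolume_idealSimplex_thirdVertex (ha : 0 < a) (hb : 0 < b) (hc : 0 < c)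
    (h : a + b + c = π) :
    hyperbolicVolume (idealSimplex (standardVertices (thirdVertex a b c))) =
      ENNReal.ofReal (angleVolume a b c) := by
  set s := idealSimplex (standardVertices (thirdVertex a b c)) with hs
  have sb : 0 < sin b := sin_pos_of_pos_of_lt_pi hb (by linarith)
  have sc : 0 < sin c := sin_pos_of_pos_of_lt_pi hc (by linarith)
  rw [hyperbolicVolume_eq_lintegral_polar
    (measurableSet_idealSimplex_standard (thirdVertex_im_pos ha hb hc h)) (fun p hp => hp.1)]
  have hzero : ∀ r f : ℝ, 0 < r → f ∈ Set.Ioo (-π) π →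
      ¬ (f ∈ Set.Icc 0 a ∧ r ≤ sin b / sin (f + b)) →
      fiberVolume s (Complex.polarCoord.symm (r, f)) = 0 := by
    intro r f hr hf hn
    have : ∀ t : ℝ, s.indicator (fun p : ℂ × ℝ => ENNReal.ofReal ((p.2 ^ 3)⁻¹))
        (Complex.polarCoord.symm (r, f), t) = 0 := fun t =>
      Set.indicator_of_notMem
        (fun hm => hn ((mem_idealSimplex_polar_iff ha hb hc h t hr hf).1 hm).1) _
    rw [fiberVolume, lintegral_congr this, lintegral_zero]
  have hval : ∀ r f : ℝ, 0 < r → f ∈ Set.Ioo (-π) π →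
      (f ∈ Set.Icc 0 a ∧ r ≤ sin b / sin (f + b)) → r < sin (f + c) / sin c →
      ENNReal.ofReal r * fiberVolume s (Complex.polarCoord.symm (r, f)) =
        ENNReal.ofReal ((2 * (sin (f + c) / sin c - r))⁻¹) := by
    intro r f hr hf hm hd
    have : ∀ t : ℝ, s.indicator (fun p : ℂ × ℝ => ENNReal.ofReal ((p.2 ^ 3)⁻¹))
        (Complex.polarCoord.symm (r, f), t) =
        {t : ℝ | 0 < t ∧ r * (sin (f + c) / sin c - r) ≤ t ^ 2}.indicator
          (fun t => ENNReal.ofReal ((t ^ 3)⁻¹)) t := fun t => by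
      have := mem_idealSimplex_polar_iff ha hb hc h t hr hf
      rw [← hs] at this
      simp only [Set.indicator, this, hm, true_and, Set.mem_ofPred_eq]
    have hd' := sub_pos.2 hd
    rw [fiberVolume, lintegral_congr this, lintegral_inv_pow_three _ (mul_pos hr hd'),
      ← ENNReal.ofReal_mul hr.le]
    congr 1
    field_simp
  have h1 : ∀ f ∈ Set.Ioo (-π) π, ∫⁻ r in Set.Ioi (0 : ℝ),
      ENNReal.ofReal r * fiberVolume s (Complex.polarCoord.symm (r, f)) =
      (Set.Icc 0 a).indicator (fun f => ∫⁻ r in Set.Ioi (0 : ℝ),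
      ENNReal.ofReal r * fiberVolume s (Complex.polarCoord.symm (r, f))) f := by
    intro f hf
    by_cases hfa : f ∈ Set.Icc 0 a
    · rw [Set.indicator_of_mem hfa]
    · rw [Set.indicator_of_notMem hfa, setLIntegral_congr_fun measurableSet_Ioi
        (g := fun _ => 0), lintegral_zero]
      intro r hr
      simp only
      rw [hzero r f hr hf (fun hh => hfa hh.1), mul_zero]
  have hsub : Set.Icc 0 a ⊆ Set.Ioo (-π) π := fun f hf => ⟨by linarith [hf.1, pi_pos],
    by linarith [hf.2]⟩
  rw [setLIntegral_congr_fun measurableSet_Ioo h1, lintegral_indicator measurableSet_Icc,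
    Measure.restrict_restrict measurableSet_Icc, Set.inter_eq_left.2 hsub,
    ← restrict_Ioo_eq_restrict_Icc]
  have h2 : ∀ f ∈ Set.Ioo 0 a, ∫⁻ r in Set.Ioi (0 : ℝ),
      ENNReal.ofReal r * fiberVolume s (Complex.polarCoord.symm (r, f)) =
      ENNReal.ofReal ((log (sin (f + b)) + log (sin (f + c)) -
        log (sin f) - log (sin (a - f))) / 2) := by
    intro f hf
    have hf' := hsub ⟨hf.1.le, hf.2.le⟩
    obtain ⟨hl, hd, hlog⟩ := radius_bounds ha hb hc h hf
    have h3 : ∀ r ∈ Set.Ioi (0 : ℝ), ENNReal.ofReal r *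
        fiberVolume s (Complex.polarCoord.symm (r, f)) =
        (Set.Ioc 0 (sin b / sin (f + b))).indicator
          (fun r => ENNReal.ofReal ((2 * (sin (f + c) / sin c - r))⁻¹)) r := by
      intro r hr
      by_cases hrl : r ≤ sin b / sin (f + b)
      · rw [Set.indicator_of_mem (show r ∈ Set.Ioc 0 _ from ⟨hr, hrl⟩),
          hval r f hr hf' ⟨⟨hf.1.le, hf.2.le⟩, hrl⟩ (hrl.trans_lt hd)]
      · rw [Set.indicator_of_notMem (fun hh => hrl hh.2), hzero r f hr hf' (fun hh => hrl hh.2),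
          mul_zero]
    rw [setLIntegral_congr_fun measurableSet_Ioi h3, lintegral_indicator measurableSet_Ioc,
      Measure.restrict_restrict measurableSet_Ioc,
      Set.inter_eq_left.2 Set.Ioc_subset_Ioi_self, lintegral_inv_sub hl hd, hlog]
  rw [setLIntegral_congr_fun measurableSet_Ioo h2,
    ← ofReal_integral_eq_lintegral_ofReal
      (by rw [restrict_Ioo_eq_restrict_Ioc]; exact intervalIntegrable_half_log_sin.1),
    restrict_Ioo_eq_restrict_Ioc, ← intervalIntegral.integral_of_le ha.le, integral_half_log_sin h]
  filter_upwards [ae_restrict_mem measurableSet_Ioo] with f hf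
  obtain ⟨hl, hd, hlog⟩ := radius_bounds ha hb hc h hf
  rw [← hlog]
  exact div_nonneg (sub_nonneg.2 (log_le_log (sub_pos.2 hd) (by linarith))) two_pos.le

end

end

section

open MeasureTheory Real

/-! ## Degenerate ideal simplices -/

theorem volume_linear_eq_zero (L : ℂ →ₗ[ℝ] ℝ) (hL : L ≠ 0) (d : ℝ) :
    volume {w : ℂ | L w = d} = 0 := by
  rcases Set.eq_empty_or_nonempty {w : ℂ | L w = d} with h | ⟨w₀, hw₀⟩
  · rw [h, measure_empty]
  · have : {w : ℂ | L w = d} = (fun w => w + -w₀) ⁻¹' (LinearMap.ker L : Set ℂ) := by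
      ext w
      simp only [Set.mem_ofPred_eq] at hw₀
      simp [← sub_eq_add_neg, sub_eq_zero, hw₀]
    rw [this, measure_preimage_add_right]
    exact Measure.addHaar_submodule _ _ fun h => hL (LinearMap.ker_eq_top.1 h)

/-- The pairing of `(a, d, b) : ℝ × ℝ × ℂ` with Hermitian matrices. -/
def hermitianPairing (M : Matrix (Fin 2) (Fin 2) ℂ) : ℝ × ℝ × ℂ →ₗ[ℝ] ℝ where
  toFun x := x.1 * (M 0 0).re + x.2.1 * (M 1 1).re + (x.2.2 * M 0 1).re
  map_add' x y := by simp only [Prod.fst_add, Prod.snd_add, add_mul, Complex.add_re]; ring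
  map_smul' r x := by
    simp only [Prod.smul_fst, Prod.smul_snd, smul_eq_mul, RingHom.id_apply, Complex.real_smul,
      mul_assoc, Complex.re_ofReal_mul]
    ring

theorem hermitianPairing_apply (M : Matrix (Fin 2) (Fin 2) ℂ) (x : ℝ × ℝ × ℂ) :
    hermitianPairing M x = x.1 * (M 0 0).re + x.2.1 * (M 1 1).re + (x.2.2 * M 0 1).re := rfl

theorem hermitianPairing_smul (c : ℝ) (M : Matrix (Fin 2) (Fin 2) ℂ) (x : ℝ × ℝ × ℂ) :
    hermitianPairing ((c : ℂ) • M) x = c * hermitianPairing M x := by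
  simp only [hermitianPairing_apply, Matrix.smul_apply, smul_eq_mul, mul_left_comm x.2.2,
    Complex.re_ofReal_mul]
  ring

theorem hermitianPairing_sum (c : Fin 4 → ℝ) (M : Fin 4 → Matrix (Fin 2) (Fin 2) ℂ)
    (x : ℝ × ℝ × ℂ) :
    hermitianPairing (∑ i, (c i : ℂ) • M i) x = ∑ i, c i * hermitianPairing (M i) x := by
  simp only [← hermitianPairing_smul]
  simp only [hermitianPairing_apply, Matrix.sum_apply, Finset.mul_sum, Complex.re_sum,
    Finset.sum_add_distrib]

/-- In upper half-space the equation reads `a (|w|² + t²) + d + Re (b w) = 0`. If `a ≠ 0` it has at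
most two solutions on each vertical line; otherwise it is solvable only above a real line of `ℂ`, or
nowhere. -/
theorem hyperbolicVolume_hermitianPairing_eq_zero (x : ℝ × ℝ × ℂ) (hx : x ≠ 0) :
    hyperbolicVolume {p | p ∈ upperHalfSpace ∧ hermitianPairing (toHyperboloid p) x = 0} = 0 := by
  obtain ⟨a, d, b⟩ := x
  have hsub : {p | p ∈ upperHalfSpace ∧ hermitianPairing (toHyperboloid p) (a, d, b) = 0} ⊆
      {p : ℂ × ℝ | a * (‖p.1‖ ^ 2 + p.2 ^ 2) + d + (b * p.1).re = 0} := by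
    rintro p ⟨hp, h⟩
    have hp' : 0 < p.2 := hp
    have e : hermitianPairing (toHyperboloid p) (a, d, b) =
        p.2⁻¹ * (a * (‖p.1‖ ^ 2 + p.2 ^ 2) + d + (b * p.1).re) := by
      have h1 : (toHyperboloid p 0 0).re = p.2⁻¹ * (‖p.1‖ ^ 2 + p.2 ^ 2) := by
        simp only [toHyperboloid, Matrix.smul_apply, smul_eq_mul, Matrix.of_apply,
          Matrix.cons_val_zero, ← Complex.ofReal_mul, Complex.ofReal_re]
      have h2 : (toHyperboloid p 1 1).re = p.2⁻¹ := by simp [toHyperboloid]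
      have h3 : (b * toHyperboloid p 0 1).re = p.2⁻¹ * (b * p.1).re := by
        simp only [toHyperboloid, Matrix.smul_apply, smul_eq_mul, Matrix.of_apply,
          Matrix.cons_val_zero, Matrix.cons_val_one, Matrix.cons_val_fin_one]
        rw [mul_left_comm, Complex.re_ofReal_mul]
      rw [hermitianPairing_apply, h1, h2, h3]
      ring
    rw [e] at h
    exact (mul_eq_zero.1 h).resolve_left (inv_pos.2 hp').ne'
  refine measure_mono_null hsub ?_
  refine (withDensity_absolutelyContinuous _ _) (Measure.absolutelyContinuous_of_le
    Measure.restrict_le_self ?_)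
  have hm : MeasurableSet {p : ℂ × ℝ | a * (‖p.1‖ ^ 2 + p.2 ^ 2) + d + (b * p.1).re = 0} := by
    refine measurableSet_eq_fun ?_ measurable_const
    have : Measurable fun p : ℂ × ℝ => (b * p.1).re :=
      Complex.measurable_re.comp (by fun_prop)
    fun_prop
  rw [Measure.volume_eq_prod, Measure.measure_prod_null hm]
  by_cases ha : a = 0
  · subst ha
    let L : ℂ →ₗ[ℝ] ℝ := Complex.reLm ∘ₗ (LinearMap.mulLeft ℝ b)
    have hnull : volume {w : ℂ | L w = -d} = 0 := by
      by_cases hb : b = 0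
      · have hd : d ≠ 0 := by
          rintro rfl
          exact hx (by simp [hb])
        have : {w : ℂ | L w = -d} = ∅ := by
          ext w
          simp [L, hb]
          exact fun h => hd (by linarith)
        rw [this, measure_empty]
      · refine volume_linear_eq_zero L (fun h => ?_) (-d)
        have := LinearMap.congr_fun h b⁻¹
        simp [L, hb] at this
    have hae : ∀ᵐ w : ℂ, L w ≠ -d := measure_eq_zero_iff_ae_notMem.1 hnull
    filter_upwards [hae] with w hw
    have : Prod.mk w ⁻¹' {p : ℂ × ℝ | 0 * (‖p.1‖ ^ 2 + p.2 ^ 2) + d + (b * p.1).re = 0} = ∅ := by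
      ext t
      simp only [Set.mem_preimage, Set.mem_ofPred_eq, Set.mem_empty_iff_false, iff_false]
      intro h
      apply hw
      change (b * w).re = -d
      linarith
    rw [this, measure_empty]
    rfl
  · refine Filter.Eventually.of_forall fun w => ?_
    refine Set.Finite.measure_zero ?_ _
    have hfin : Set.Finite {t : ℝ | t ^ 2 = -(d + (b * w).re) / a - ‖w‖ ^ 2} := by
      set q := -(d + (b * w).re) / a - ‖w‖ ^ 2
      refine Set.Finite.subset (Set.toFinite {√q, -√q}) fun t (ht : t ^ 2 = q) => ?_
      have hq : √q = |t| := by rw [← ht, sqrt_sq_eq_abs]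
      rw [hq]
      rcases abs_choice t with h | h <;> simp [h]
    refine hfin.subset fun t ht => ?_
    have ht' : a * (‖w‖ ^ 2 + t ^ 2) + d + (b * w).re = 0 := ht
    change t ^ 2 = _
    field_simp
    linarith

theorem simplexVolume_eq_zero_of_pairing (v : Fin 4 → Fin 2 → ℂ) (x : ℝ × ℝ × ℂ) (hx : x ≠ 0)
    (h : ∀ i, hermitianPairing (lightVector (v i)) x = 0) : simplexVolume v = 0 := by
  have : hyperbolicVolume (idealSimplex v) = 0 := by
    refine measure_mono_null ?_ (hyperbolicVolume_hermitianPairing_eq_zero x hx)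
    rintro p ⟨hp, c, -, hs⟩
    refine ⟨hp, ?_⟩
    rw [hs, hermitianPairing_sum]
    simp [h]
  rw [simplexVolume, this, ENNReal.toReal_zero]

theorem exists_smul_of_det₂_eq_zero {u v : Fin 2 → ℂ} (hu : u ≠ 0) (h : det₂ u v = 0) :
    ∃ k : ℂ, v = k • u := by
  rw [det₂, sub_eq_zero] at h
  by_cases h0 : u 0 = 0
  · have h1 : u 1 ≠ 0 := fun h1 => hu (by ext i; fin_cases i <;> simp [h0, h1])
    refine ⟨v 1 / u 1, ?_⟩
    have : v 0 = 0 := by simpa [h0, h1] using h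
    ext i; fin_cases i <;> simp [h0, h1, this]
  · refine ⟨v 0 / u 0, ?_⟩
    ext i
    fin_cases i
    · simp [h0]
    · simp only [Fin.mk_one, Fin.isValue, Pi.smul_apply, smul_eq_mul]
      field_simp
      linear_combination h

theorem simplexVolume_eq_zero_of_det₂_eq_zero (v : Fin 4 → Fin 2 → ℂ) {i j : Fin 4} (hij : i ≠ j)
    (hi : v i ≠ 0) (h : det₂ (v i) (v j) = 0) : simplexVolume v = 0 := by
  obtain ⟨k, hk⟩ := exists_smul_of_det₂_eq_zero hi h
  -- Three linear conditions on a four-dimensional real space have a nonzero common solution; the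
  -- condition for `j` follows from the one for `i`, since their light rays are proportional.
  let φ : ℝ × ℝ × ℂ →ₗ[ℝ] ({l : Fin 4 // l ≠ j} → ℝ) :=
    LinearMap.pi fun l => hermitianPairing (lightVector (v l))
  have hφ : LinearMap.ker φ ≠ ⊥ := by
    refine LinearMap.ker_ne_bot_of_finrank_lt ?_
    have : Fintype.card {l : Fin 4 // l ≠ j} = 3 := by
      rw [Fintype.card_subtype_compl]; simp
    simp [Module.finrank_prod, this]
  obtain ⟨x, hx, hx0⟩ := Submodule.exists_mem_ne_zero_of_ne_bot hφ
  have hx' : ∀ l, l ≠ j → hermitianPairing (lightVector (v l)) x = 0 := fun l hl =>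
    congrFun (LinearMap.mem_ker.1 hx) ⟨l, hl⟩
  refine simplexVolume_eq_zero_of_pairing v x hx0 fun l => ?_
  rcases eq_or_ne l j with rfl | hl
  · have e : hermitianPairing (lightVector (v l)) x =
        ‖k‖ ^ 2 * hermitianPairing (lightVector (v i)) x := by
      rw [hk, lightVector_smul, hermitianPairing_smul]
    rw [e, hx' i hij, mul_zero]
  · exact hx' l hl

theorem simplexVolume_standard_of_im_eq_zero {z : ℂ} (hz : z.im = 0) :
    simplexVolume (standardVertices z) = 0 := by
  refine simplexVolume_eq_zero_of_pairing _ (0, 0, Complex.I) (by simp) fun i => ?_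
  fin_cases i <;> simp [hermitianPairing_apply, lightVector_apply, standardVertices, hz]

/-! ## Ideal simplices of maximal volume -/

/-- The angles at `0` and `1` are the arguments of `z` and of the conjugate of `1 - z`. The law of
sines `‖z‖ sin (a + b) = sin b` forces `a + b < π`. -/
theorem exists_eq_thirdVertex {z : ℂ} (hz : 0 < z.im) :
    ∃ a b c : ℝ, 0 < a ∧ 0 < b ∧ 0 < c ∧ a + b + c = π ∧ z = thirdVertex a b c := by
  have hpos : ∀ w : ℂ, 0 < w.im → 0 < w.arg ∧ w.arg < π := fun w hw =>
    ⟨lt_of_le_of_ne (Complex.arg_nonneg_iff.2 hw.le) fun h => by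
      have := (Complex.arg_eq_zero_iff.1 h.symm).2; linarith,
      Complex.arg_lt_pi_iff.2 (Or.inr hw.ne')⟩
  have hu : 0 < ((starRingEnd ℂ) (1 - z)).im := by simpa using hz
  set u := (starRingEnd ℂ) (1 - z) with hudef
  obtain ⟨ha, ha'⟩ := hpos z hz
  obtain ⟨hb, hb'⟩ := hpos u hu
  have nz : 0 < ‖z‖ := norm_pos_iff.2 fun h => by simp [h] at hz
  have nu : 0 < ‖u‖ := norm_pos_iff.2 fun h => by simp [h] at hu
  have z1 : z.re = ‖z‖ * cos z.arg := (Complex.norm_mul_cos_arg z).symm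
  have z2 : z.im = ‖z‖ * sin z.arg := (Complex.norm_mul_sin_arg z).symm
  have u1 : u.re = ‖u‖ * cos u.arg := (Complex.norm_mul_cos_arg u).symm
  have u2 : u.im = ‖u‖ * sin u.arg := (Complex.norm_mul_sin_arg u).symm
  have u3 : u.re = 1 - z.re := by simp [hudef]
  have u4 : u.im = z.im := by simp [hudef]
  set a := z.arg
  set b := u.arg
  have hsb : 0 < sin b := sin_pos_of_pos_of_lt_pi hb hb'
  have key : ‖z‖ * sin (a + b) = sin b := by
    rw [sin_add]
    have : ‖u‖ * (‖z‖ * (sin a * cos b + cos a * sin b)) = ‖u‖ * sin b := by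
      calc _ = (‖z‖ * sin a) * (‖u‖ * cos b) + (‖z‖ * cos a) * (‖u‖ * sin b) := by ring
        _ = z.im * u.re + z.re * u.im := by rw [z1, z2, u1, u2]
        _ = u.im := by rw [u3, u4]; ring
        _ = _ := u2
    exact mul_left_cancel₀ nu.ne' this
  have hab : a + b < π := by
    by_contra hab
    have : sin (a + b) ≤ 0 := by
      have h := sin_nonneg_of_nonneg_of_le_pi (x := a + b - π) (by linarith) (by linarith)
      rw [sin_sub_pi] at h
      linarith
    have := mul_nonpos_of_nonneg_of_nonpos nz.le this
    linarith
  refine ⟨a, b, π - a - b, ha, hb, by linarith, by ring, ?_⟩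
  have hs : sin (π - a - b) = sin (a + b) := by
    rw [show π - a - b = π - (a + b) by ring, sin_pi_sub]
  have hsab : sin (a + b) ≠ 0 := fun h => by rw [h, mul_zero] at key; exact hsb.ne key
  have hq : sin b / sin (π - a - b) = ‖z‖ := by
    rw [hs, ← key]; field_simp
  apply Complex.ext
  · rw [thirdVertex_re, hq, z1]
  · rw [thirdVertex_im, hq, z2]

/-- The common value of the cross-ratios of positively oriented regular ideal tetrahedra. -/
def regularVertex : ℂ := thirdVertex (π / 3) (π / 3) (π / 3)

/-- The volume of the regular ideal tetrahedron. -/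
def regularVolume : ℝ := angleVolume (π / 3) (π / 3) (π / 3)

theorem regularVertex_im_pos : 0 < regularVertex.im :=
  thirdVertex_im_pos (by positivity) (by positivity) (by positivity) (by ring)

theorem simplexVolume_thirdVertex {a b c : ℝ} (ha : 0 < a) (hb : 0 < b) (hc : 0 < c)
    (h : a + b + c = π) :
    simplexVolume (standardVertices (thirdVertex a b c)) = angleVolume a b c := by
  rw [simplexVolume, hyperbolicVolume_idealSimplex_thirdVertex ha hb hc h,
    ENNReal.toReal_ofReal (angleVolume_nonneg ha hb hc h)]

theorem simplexVolume_regularVertex :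
    simplexVolume (standardVertices regularVertex) = regularVolume :=
  simplexVolume_thirdVertex (by positivity) (by positivity) (by positivity) (by ring)

/-- The regular volume strictly exceeds the nonnegative volume for the angles `π / 2, π / 4, π / 4`.
-/
theorem regularVolume_pos : 0 < regularVolume := by
  have h := pi_pos
  refine (angleVolume_nonneg (a := π / 2) (b := π / 4) (c := π / 4) (by linarith) (by linarith)
    (by linarith) (by ring)).trans_lt (angleVolume_lt (by linarith) (by linarith)
    (by linarith) (by ring) fun hh => ?_)
  linarith [hh.1]

theorem simplexVolume_standard_of_im_pos {z : ℂ} (hz : 0 < z.im) :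
    simplexVolume (standardVertices z) ≤ regularVolume ∧
      (simplexVolume (standardVertices z) = regularVolume → z = regularVertex) := by
  obtain ⟨a, b, c, ha, hb, hc, h, rfl⟩ := exists_eq_thirdVertex hz
  rw [simplexVolume_thirdVertex ha hb hc h]
  by_cases hr : a = π / 3 ∧ b = π / 3
  · obtain ⟨rfl, rfl⟩ := hr
    obtain rfl : c = π / 3 := by linarith
    exact ⟨le_rfl, fun _ => rfl⟩
  · have := angleVolume_lt ha hb hc h hr
    exact ⟨this.le, fun he => absurd he this.ne⟩

theorem simplexVolume_standard_conj (z : ℂ) :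
    simplexVolume (standardVertices ((starRingEnd ℂ) z)) = simplexVolume (standardVertices z) := by
  rw [← simplexVolume_conj]
  congr 1
  ext i j
  fin_cases i <;> fin_cases j <;> simp [standardVertices]

theorem simplexVolume_eq_standard (v : Fin 4 → Fin 2 → ℂ) (h01 : det₂ (v 0) (v 1) ≠ 0)
    (h02 : det₂ (v 0) (v 2) ≠ 0) (h03 : det₂ (v 0) (v 3) ≠ 0) (h12 : det₂ (v 1) (v 2) ≠ 0) :
    simplexVolume v = simplexVolume (standardVertices (crossRatio v)) := by
  -- The rows are `det₂ (v 1) ·` and `det₂ (v 0) ·`, scaled so that `v 2` maps to `(1, 1)`; then `v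
  -- 0` maps to `∞` and `v 1` to `0`.
  let g : Matrix (Fin 2) (Fin 2) ℂ :=
    !![-v 1 1 / det₂ (v 1) (v 2), v 1 0 / det₂ (v 1) (v 2);
      -v 0 1 / det₂ (v 0) (v 2), v 0 0 / det₂ (v 0) (v 2)]
  have hg : g.det ≠ 0 := by
    have : g.det = -det₂ (v 0) (v 1) / (det₂ (v 1) (v 2) * det₂ (v 0) (v 2)) := by
      rw [Matrix.det_fin_two_of]
      field_simp
      rw [det₂]
      ring
    rw [this]
    exact div_ne_zero (neg_ne_zero.2 h01) (mul_ne_zero h12 h02)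
  rw [← simplexVolume_mulVec g hg v]
  refine Eq.trans ?_ (simplexVolume_smul (standardVertices (crossRatio v))
    ![-det₂ (v 0) (v 1) / det₂ (v 1) (v 2), det₂ (v 0) (v 1) / det₂ (v 0) (v 2), 1,
      det₂ (v 0) (v 3) / det₂ (v 0) (v 2)] ?_)
  · congr 1
    ext i j
    fin_cases i <;> fin_cases j <;>
      simp [g, standardVertices, crossRatio, Matrix.vecHead, Matrix.vecTail] <;> field_simp <;>
      simp only [det₂] <;> ring
  · intro i
    fin_cases i
    · exact div_ne_zero (neg_ne_zero.2 h01) h12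
    · exact div_ne_zero h01 h02
    · exact one_ne_zero
    · exact div_ne_zero h03 h02

theorem simplexVolume_le_regularVolume (v : Fin 4 → Fin 2 → ℂ) (hv : ∀ i, v i ≠ 0) :
    simplexVolume v ≤ regularVolume ∧ (simplexVolume v = regularVolume →
      crossRatio v = regularVertex ∨ crossRatio v = (starRingEnd ℂ) regularVertex) := by
  have hzero : simplexVolume v = 0 → simplexVolume v ≤ regularVolume ∧
      (simplexVolume v = regularVolume →
        crossRatio v = regularVertex ∨ crossRatio v = (starRingEnd ℂ) regularVertex) := fun h =>
    ⟨h ▸ regularVolume_pos.le, fun h' => absurd (h.symm.trans h') regularVolume_pos.ne⟩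
  by_cases hdeg : ∃ i j, i ≠ j ∧ det₂ (v i) (v j) = 0
  · obtain ⟨i, j, hij, h⟩ := hdeg
    exact hzero (simplexVolume_eq_zero_of_det₂_eq_zero v hij (hv i) h)
  · push Not at hdeg
    have hstd := simplexVolume_eq_standard v (hdeg 0 1 (by decide)) (hdeg 0 2 (by decide))
      (hdeg 0 3 (by decide)) (hdeg 1 2 (by decide))
    rcases lt_trichotomy (crossRatio v).im 0 with hz | hz | hz
    · rw [hstd, ← simplexVolume_standard_conj]
      obtain ⟨h1, h2⟩ := simplexVolume_standard_of_im_pos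
        (z := (starRingEnd ℂ) (crossRatio v)) (by simpa using hz)
      refine ⟨h1, fun h => Or.inr ?_⟩
      rw [← h2 h, Complex.conj_conj]
    · exact hzero (hstd.trans (simplexVolume_standard_of_im_eq_zero hz))
    · rw [hstd]
      obtain ⟨h1, h2⟩ := simplexVolume_standard_of_im_pos hz
      exact ⟨h1, fun h => Or.inl (h2 h)⟩

theorem v₃_eq_regularVolume : v₃ = regularVolume := by
  refine IsLUB.csSup_eq (s := {r : ℝ | ∃ v : Fin 4 → Fin 2 → ℂ, (∀ i, v i ≠ 0) ∧
    r = simplexVolume v}) (IsGreatest.isLUB ⟨⟨standardVertices regularVertex, fun i => ?_,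
      simplexVolume_regularVertex.symm⟩, ?_⟩) ⟨_, standardVertices regularVertex, fun i => ?_, rfl⟩
  · fin_cases i <;> simp [standardVertices]
  · rintro r ⟨v, hv, rfl⟩
    exact (simplexVolume_le_regularVolume v hv).1
  · fin_cases i <;> simp [standardVertices]

theorem v₃_pos : 0 < v₃ := v₃_eq_regularVolume ▸ regularVolume_pos

theorem abs_volH3_le (v : Fin 4 → Fin 2 → ℂ) (hv : ∀ i, v i ≠ 0) : |volH3 v| ≤ v₃ := by
  have h0 : 0 ≤ simplexVolume v := ENNReal.toReal_nonneg
  have h1 := (simplexVolume_le_regularVolume v hv).1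
  rw [← v₃_eq_regularVolume] at h1
  have h2 : |Real.sign (crossRatio v).im| ≤ 1 := by
    rcases Real.sign_apply_eq (crossRatio v).im with h | h | h <;> simp [h]
  rw [volH3, abs_mul, abs_of_nonneg h0]
  calc _ ≤ 1 * simplexVolume v := mul_le_mul_of_nonneg_right h2 h0
    _ ≤ v₃ := by rwa [one_mul]

theorem det₂_ne_zero_of_volH3_ne_zero {v : Fin 4 → Fin 2 → ℂ} (hv : ∀ i, v i ≠ 0)
    (h : volH3 v ≠ 0) {i j : Fin 4} (hij : i ≠ j) : det₂ (v i) (v j) ≠ 0 := fun hd =>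
  h (by rw [volH3, simplexVolume_eq_zero_of_det₂_eq_zero v hij (hv i) hd, mul_zero])

theorem crossRatio_eq_of_abs_volH3_eq {v : Fin 4 → Fin 2 → ℂ} (hv : ∀ i, v i ≠ 0)
    (h : |volH3 v| = v₃) :
    crossRatio v = if 0 < volH3 v then regularVertex else (starRingEnd ℂ) regularVertex := by
  have h0 : 0 ≤ simplexVolume v := ENNReal.toReal_nonneg
  have h3 := v₃_pos
  have hr := regularVertex_im_pos
  obtain ⟨h1, h2⟩ := simplexVolume_le_regularVolume v hv
  rw [← v₃_eq_regularVolume] at h1 h2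
  have h4 : simplexVolume v = v₃ := by
    rcases Real.sign_apply_eq (crossRatio v).im with hs | hs | hs <;>
      rw [volH3, hs] at h <;> simp at h
    · rwa [abs_of_nonneg h0] at h
    · exact absurd h h3.ne
    · rwa [abs_of_nonneg h0] at h
  rcases h2 h4 with hc | hc
  · rw [if_pos, hc]
    rw [volH3, hc, Real.sign_of_pos hr, h4, one_mul]
    exact h3
  · rw [if_neg, hc]
    rw [volH3, hc, Real.sign_of_neg (by simpa using hr), h4]
    linarith

/-- Three vertices, the orientation, and maximality determine the fourth vertex. -/
theorem det₂_eq_zero_of_volH3_eq {v v' : Fin 4 → Fin 2 → ℂ} (hv : ∀ i, v i ≠ 0)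
    (hv' : ∀ i, v' i ≠ 0) (h0 : v 0 = v' 0) (h1 : v 1 = v' 1) (h2 : v 2 = v' 2)
    (h : |volH3 v| = v₃) (he : volH3 v' = volH3 v) : det₂ (v 3) (v' 3) = 0 := by
  have hn : volH3 v ≠ 0 := fun hh => by
    rw [hh, abs_zero] at h
    exact v₃_pos.ne h
  have hn' : volH3 v' ≠ 0 := he ▸ hn
  have c := crossRatio_eq_of_abs_volH3_eq hv h
  have c' := crossRatio_eq_of_abs_volH3_eq hv' (he ▸ h)
  rw [he] at c'
  have hc := c.trans c'.symm
  have d01 := det₂_ne_zero_of_volH3_ne_zero hv hn (i := 0) (j := 1) (by decide)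
  have d02 := det₂_ne_zero_of_volH3_ne_zero hv hn (i := 0) (j := 2) (by decide)
  have d12 := det₂_ne_zero_of_volH3_ne_zero hv hn (i := 1) (j := 2) (by decide)
  have d03 := det₂_ne_zero_of_volH3_ne_zero hv hn (i := 0) (j := 3) (by decide)
  have d03' := det₂_ne_zero_of_volH3_ne_zero hv' hn' (i := 0) (j := 3) (by decide)
  rw [crossRatio, crossRatio, ← h0, ← h1, ← h2] at hc
  rw [← h0] at d03'
  rw [div_eq_div_iff (mul_ne_zero d03 d12) (mul_ne_zero d03' d12)] at hc
  have hc' : det₂ (v 1) (v 3) * det₂ (v 0) (v' 3) = det₂ (v 1) (v' 3) * det₂ (v 0) (v 3) := by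
    apply mul_left_cancel₀ (mul_ne_zero d02 d12)
    linear_combination hc
  -- Plücker relation among `v 0`, `v 1`, `v 3`, `v' 3`.
  apply (mul_eq_zero.1 _).resolve_left d01
  simp only [det₂] at hc' ⊢
  linear_combination -hc'

end

section

open Module

/-! ## The terms of the sum -/

theorem det₂_smul_eq (u v w : Fin 2 → ℂ) : det₂ u v • w = det₂ w v • u + det₂ u w • v := by
  ext i
  fin_cases i <;> simp [det₂] <;> ring

section Quotient

variable {V : Type*} [AddCommGroup V] [Module ℂ V] [FiniteDimensional ℂ V]

theorem abs_Vol_le (x : Fin 4 → V) : |Vol V x| ≤ v₃ := by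
  unfold Vol
  split_ifs with h hx
  · exact abs_volH3_le _ fun i hi => hx i ((LinearEquiv.map_eq_zero_iff _).1 hi)
  · simpa using v₃_pos.le
  · simpa using v₃_pos.le

/-- The linear algebra of the counting needs only this from a nonzero volume: the space is a plane
and the four ideal points are distinct. -/
theorem exists_equiv_of_Vol_ne_zero {x : Fin 4 → V} (h : Vol V x ≠ 0) :
    ∃ e : V ≃ₗ[ℂ] (Fin 2 → ℂ), (∀ i j, i ≠ j → det₂ (e (x i)) (e (x j)) ≠ 0) := by
  unfold Vol at h
  split_ifs at h with h2 hx
  · exact ⟨_, fun i j hij => det₂_ne_zero_of_volH3_ne_zero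
      (fun i hi => hx i ((LinearEquiv.map_eq_zero_iff _).1 hi)) h hij⟩
  · exact absurd rfl h
  · exact absurd rfl h

theorem finrank_eq_two_of_Vol_ne_zero {x : Fin 4 → V} (h : Vol V x ≠ 0) : finrank ℂ V = 2 := by
  unfold Vol at h
  split_ifs at h with h2 hx
  · exact h2
  · exact absurd rfl h
  · exact absurd rfl h

theorem eq_smul_of_Vol_eq {x x' : Fin 4 → V} (h0 : x 0 = x' 0) (h1 : x 1 = x' 1) (h2 : x 2 = x' 2)
    (h : |Vol V x| = v₃) (he : Vol V x' = Vol V x) : ∃ k : ℂ, x' 3 = k • x 3 := by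
  have hn : Vol V x ≠ 0 := fun hh => by
    rw [hh, abs_zero] at h
    exact v₃_pos.ne h
  have hn' : Vol V x' ≠ 0 := he ▸ hn
  have hd := finrank_eq_two_of_Vol_ne_zero hn
  unfold Vol at h he hn hn'
  rw [dif_pos hd] at h he hn hn'
  rw [dif_pos hd] at he
  have hx : ∀ i, x i ≠ 0 := by
    by_contra hx
    rw [if_neg hx] at hn
    exact hn rfl
  have hx' : ∀ i, x' i ≠ 0 := by
    by_contra hx'
    rw [if_neg hx'] at hn'
    exact hn' rfl
  rw [if_pos hx] at h he
  rw [if_pos hx'] at he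
  set e := (finBasisOfFinrankEq ℂ V hd).equivFun
  have hz : ∀ y : V, y ≠ 0 → e y ≠ 0 := fun y hy hh => hy ((LinearEquiv.map_eq_zero_iff _).1 hh)
  have := det₂_eq_zero_of_volH3_eq (v := fun i => e (x i)) (v' := fun i => e (x' i))
    (fun i => hz _ (hx i)) (fun i => hz _ (hx' i)) (by simp only [h0]) (by simp only [h1])
    (by simp only [h2]) h he
  obtain ⟨k, hk⟩ := exists_smul_of_det₂_eq_zero (hz _ (hx 3)) this
  refine ⟨k, e.injective ?_⟩
  rw [hk, map_smul]

end Quotient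

variable {n : ℕ}

/-- The contribution of the multi-index `J` to `affineB F`. -/
def term (F : Fin 4 → AffineFlag n) (J : Fin 4 → Fin n) : ℝ :=
  Vol (spanQuotient F J) (quotientVec F J)

theorem lowerSpan_le_upperSpan (F : Fin 4 → AffineFlag n) (J : Fin 4 → Fin n) :
    lowerSpan F J ≤ upperSpan F J :=
  iSup_mono fun i => (F i).monotone_subspace (Fin.castSucc_lt_succ (i := J i)).le

theorem quotientVec_combination (F : Fin 4 → AffineFlag n) (J : Fin 4 → Fin n) (i j : Fin 4)
    (a b : ℂ) :
    a • quotientVec F J i + b • quotientVec F J j = Submodule.Quotient.mk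
      ⟨a • (F i).vec (J i) + b • (F j).vec (J j), add_mem
        (Submodule.smul_mem _ _ (vec_mem_upperSpan F J i))
        (Submodule.smul_mem _ _ (vec_mem_upperSpan F J j))⟩ := rfl

section Nonzero

variable {F : Fin 4 → AffineFlag n} {J : Fin 4 → Fin n}

theorem independent_of_term_ne_zero (h : term F J ≠ 0) {i j : Fin 4} (hij : i ≠ j) {a b : ℂ}
    (hab : a • (F i).vec (J i) + b • (F j).vec (J j) ∈ lowerSpan F J) : a = 0 ∧ b = 0 := by
  obtain ⟨e, he⟩ := exists_equiv_of_Vol_ne_zero h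
  have h0 : a • quotientVec F J i + b • quotientVec F J j = 0 := by
    rw [quotientVec_combination, Submodule.Quotient.mk_eq_zero]
    exact hab
  have h1 := congrArg e h0
  rw [map_add, map_smul, map_smul, map_zero] at h1
  have c0 := congrFun h1 0
  have c1 := congrFun h1 1
  simp only [Pi.add_apply, Pi.smul_apply, smul_eq_mul, Pi.zero_apply] at c0 c1
  have hd := he i j hij
  constructor
  · refine (mul_eq_zero.1 ?_).resolve_right hd
    rw [det₂]
    linear_combination e (quotientVec F J j) 1 * c0 - e (quotientVec F J j) 0 * c1
  · refine (mul_eq_zero.1 ?_).resolve_right hd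
    rw [det₂]
    linear_combination e (quotientVec F J i) 0 * c1 - e (quotientVec F J i) 1 * c0

theorem vec_notMem_of_term_ne_zero (h : term F J ≠ 0) (i : Fin 4) :
    (F i).vec (J i) ∉ lowerSpan F J := by
  intro hi
  obtain ⟨j, hj⟩ : ∃ j, i ≠ j := ⟨i + 1, by fin_cases i <;> decide⟩
  exact one_ne_zero (independent_of_term_ne_zero h hj (a := 1) (b := 0) (by simpa using hi)).1

theorem exists_combination_of_term_ne_zero (h : term F J ≠ 0) {i j : Fin 4} (hij : i ≠ j)
    {x : Fin n → ℂ} (hx : x ∈ upperSpan F J) :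
    ∃ a b : ℂ, x - (a • (F i).vec (J i) + b • (F j).vec (J j)) ∈ lowerSpan F J := by
  obtain ⟨e, he⟩ := exists_equiv_of_Vol_ne_zero h
  have hd := he i j hij
  let q : spanQuotient F J := Submodule.Quotient.mk ⟨x, hx⟩
  set u := e (quotientVec F J i)
  set v := e (quotientVec F J j)
  refine ⟨(det₂ u v)⁻¹ * det₂ (e q) v, (det₂ u v)⁻¹ * det₂ u (e q), ?_⟩
  have hq : q = ((det₂ u v)⁻¹ * det₂ (e q) v) • quotientVec F J i +
      ((det₂ u v)⁻¹ * det₂ u (e q)) • quotientVec F J j := by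
    apply e.injective
    rw [map_add, map_smul, map_smul, mul_smul, mul_smul, ← smul_add, ← det₂_smul_eq, smul_smul,
      inv_mul_cancel₀ hd, one_smul]
  rw [quotientVec_combination] at hq
  exact (Submodule.Quotient.eq ((lowerSpan F J).submoduleOf (upperSpan F J))).1 hq

theorem finrank_lowerSpan_of_term_ne_zero (h : term F J ≠ 0) :
    finrank ℂ (lowerSpan F J) + 2 ≤ n := by
  have h2 := finrank_eq_two_of_Vol_ne_zero h
  have h3 := Submodule.finrank_quotient_add_finrank ((lowerSpan F J).submoduleOf (upperSpan F J))
  have h4 : finrank ℂ ((lowerSpan F J).submoduleOf (upperSpan F J)) = finrank ℂ (lowerSpan F J) :=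
    (Submodule.submoduleOfEquivOfLe (lowerSpan_le_upperSpan F J)).finrank_eq
  have h5 := Submodule.finrank_le (upperSpan F J)
  rw [finrank_fin_fun] at h5
  have h2' : finrank ℂ (spanQuotient F J) = 2 := h2
  unfold spanQuotient at h2'
  omega

theorem upperSpan_eq_of_term_ne_zero (h : term F J ≠ 0) {i j : Fin 4} (hij : i ≠ j) :
    upperSpan F J = lowerSpan F J ⊔ Submodule.span ℂ {(F i).vec (J i), (F j).vec (J j)} := by
  apply le_antisymm
  · intro x hx
    obtain ⟨a, b, hab⟩ := exists_combination_of_term_ne_zero h hij hx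
    rw [← sub_add_cancel x (a • (F i).vec (J i) + b • (F j).vec (J j))]
    exact Submodule.add_mem_sup hab (Submodule.mem_span_pair.2 ⟨a, b, rfl⟩)
  · refine sup_le (lowerSpan_le_upperSpan F J) (Submodule.span_le.2 ?_)
    rintro x (rfl | rfl)
    · exact vec_mem_upperSpan F J i
    · exact vec_mem_upperSpan F J j

end Nonzero

/-- Two flags that define the same maximal term, with the other flags fixed, have the same line in
the corresponding quotient. -/
theorem exists_sub_smul_mem_lowerSpan {F F' : Fin 4 → AffineFlag n} {J : Fin 4 → Fin n}
    (hF : ∀ i, i ≠ 3 → F i = F' i) (hlow : lowerSpan F J = lowerSpan F' J)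
    (hup : upperSpan F J = upperSpan F' J) (h : |term F J| = v₃) (he : term F' J = term F J) :
    ∃ k : ℂ, (F' 3).vec (J 3) - k • (F 3).vec (J 3) ∈ lowerSpan F J := by
  -- The two quotients are different types. With the subspaces as variables, the equalities can be
  -- substituted.
  have key : ∀ (U U' W W' : Submodule ℂ (Fin n → ℂ)) (_ : U = U') (_ : W = W')
      (x x' : Fin 4 → Fin n → ℂ) (hx : ∀ i, x i ∈ U) (hx' : ∀ i, x' i ∈ U'),
      (∀ i, i ≠ 3 → x i = x' i) →
      |Vol (U ⧸ W.submoduleOf U) (fun i => Submodule.Quotient.mk ⟨x i, hx i⟩)| = v₃ →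
      Vol (U' ⧸ W'.submoduleOf U') (fun i => Submodule.Quotient.mk ⟨x' i, hx' i⟩) =
        Vol (U ⧸ W.submoduleOf U) (fun i => Submodule.Quotient.mk ⟨x i, hx i⟩) →
      ∃ k : ℂ, x' 3 - k • x 3 ∈ W := by
    rintro U _ W _ rfl rfl x x' hx hx' hxx h he
    obtain ⟨k, hk⟩ := eq_smul_of_Vol_eq (by simp only [hxx 0 (by decide)])
      (by simp only [hxx 1 (by decide)]) (by simp only [hxx 2 (by decide)]) h he
    exact ⟨k, (Submodule.Quotient.eq (W.submoduleOf U) (y := k • ⟨x 3, hx 3⟩)).1 hk⟩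
  exact key _ _ _ _ hup hlow (fun i => (F i).vec (J i)) (fun i => (F' i).vec (J i))
    (vec_mem_upperSpan F J) (vec_mem_upperSpan F' J) (fun i hi => by simp only [hF i hi]) h he

/-! ## Counting the nonzero terms -/

theorem vec_mem_of_lt (A : AffineFlag n) {j k : Fin n} (h : j < k) :
    A.vec j ∈ A.subspace k.castSucc := by
  have h1 : A.vec j ∈ A.subspace j.succ := by
    rw [A.subspace_succ]
    exact Submodule.mem_sup_left (Submodule.mem_span_singleton_self _)
  exact A.monotone_subspace (by rw [Fin.le_def]; simpa using h) h1

/-- The span of the members of the flags `3` and `0`. -/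
def span₂ (F : Fin 4 → AffineFlag n) (J : Fin 4 → Fin n) : Submodule ℂ (Fin n → ℂ) :=
  (F 3).subspace (J 3).castSucc ⊔ (F 0).subspace (J 0).castSucc

/-- The span of the members of the flags `3`, `0` and `1`. -/
def span₃ (F : Fin 4 → AffineFlag n) (J : Fin 4 → Fin n) : Submodule ℂ (Fin n → ℂ) :=
  span₂ F J ⊔ (F 1).subspace (J 1).castSucc

theorem lowerSpan_eq (F : Fin 4 → AffineFlag n) (J : Fin 4 → Fin n) :
    lowerSpan F J = span₃ F J ⊔ (F 2).subspace (J 2).castSucc := by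
  apply le_antisymm
  · refine iSup_le fun i => ?_
    fin_cases i
    · exact (le_sup_right.trans le_sup_left).trans le_sup_left
    · exact le_sup_right.trans le_sup_left
    · exact le_sup_right
    · exact (le_sup_left.trans le_sup_left).trans le_sup_left
  · have h := fun i => le_iSup (fun i => (F i).subspace (J i).castSucc) i
    exact sup_le (sup_le (sup_le (h 3) (h 0)) (h 1)) (h 2)

theorem span₂_le_lowerSpan (F : Fin 4 → AffineFlag n) (J : Fin 4 → Fin n) :
    span₂ F J ≤ lowerSpan F J :=
  lowerSpan_eq F J ▸ le_sup_left.trans le_sup_left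

theorem span₃_le_lowerSpan (F : Fin 4 → AffineFlag n) (J : Fin 4 → Fin n) :
    span₃ F J ≤ lowerSpan F J :=
  lowerSpan_eq F J ▸ le_sup_left

section Injectivity

variable {F F' : Fin 4 → AffineFlag n} {J J' : Fin 4 → Fin n}

/-- Nested spans of equal dimension coincide, so `J 0 < J' 0` would put the vector of flag 0 at `J
0` into the lower span of `J` and kill the term. -/
theorem not_lt_zero_of_term_ne_zero (hF : ∀ i, i ≠ 3 → F i = F' i) (h : term F J ≠ 0)
    (h3 : (F 3).subspace (J 3).castSucc = (F' 3).subspace (J' 3).castSucc)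
    (hd : finrank ℂ (span₂ F J) = finrank ℂ (span₂ F' J')) : ¬ J 0 < J' 0 := by
  intro hlt
  have hle : span₂ F J ≤ span₂ F' J' := by
    rw [span₂, span₂, h3, hF 0 (by decide)]
    exact sup_le_sup_left ((F' 0).monotone_subspace (Fin.castSucc_le_castSucc_iff.2 hlt.le)) _
  have heq := Submodule.eq_of_le_of_finrank_eq hle hd
  refine vec_notMem_of_term_ne_zero h 0 (span₂_le_lowerSpan F J ?_)
  rw [heq, hF 0 (by decide)]
  exact Submodule.mem_sup_right (vec_mem_of_lt _ hlt)

theorem not_lt_one_of_term_ne_zero (hF : ∀ i, i ≠ 3 → F i = F' i) (h : term F J ≠ 0)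
    (h2 : span₂ F J = span₂ F' J')
    (hd : finrank ℂ (span₃ F J) = finrank ℂ (span₃ F' J')) : ¬ J 1 < J' 1 := by
  intro hlt
  have hle : span₃ F J ≤ span₃ F' J' := by
    rw [span₃, span₃, h2, hF 1 (by decide)]
    exact sup_le_sup_left ((F' 1).monotone_subspace (Fin.castSucc_le_castSucc_iff.2 hlt.le)) _
  have heq := Submodule.eq_of_le_of_finrank_eq hle hd
  refine vec_notMem_of_term_ne_zero h 1 (span₃_le_lowerSpan F J ?_)
  rw [heq, hF 1 (by decide)]
  exact Submodule.mem_sup_right (vec_mem_of_lt _ hlt)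

/-- No dimension is prescribed here; planarity replaces it. Modulo the lower span of `J`, the vector
of flag 2 is `a v₀ + b v₁`. If `J 2 < J' 2`, this combination lies in the lower span of `J'`, so `a
= b = 0` by independence there, and the vector vanishes in the quotient for `J`. -/
theorem not_lt_two_of_term_ne_zero (hF : ∀ i, i ≠ 3 → F i = F' i) (h : term F J ≠ 0)
    (h' : term F' J' ≠ 0) (h0 : J 0 = J' 0) (h1 : J 1 = J' 1)
    (h3 : span₃ F J = span₃ F' J') : ¬ J 2 < J' 2 := by
  intro hlt
  have hle : lowerSpan F J ≤ lowerSpan F' J' := by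
    rw [lowerSpan_eq, lowerSpan_eq, h3, hF 2 (by decide)]
    exact sup_le_sup_left ((F' 2).monotone_subspace (Fin.castSucc_le_castSucc_iff.2 hlt.le)) _
  obtain ⟨a, b, hab⟩ := exists_combination_of_term_ne_zero h (i := 0) (j := 1) (by decide)
    (vec_mem_upperSpan F J 2)
  have hmem : (F 2).vec (J 2) ∈ lowerSpan F' J' := by
    rw [lowerSpan_eq, hF 2 (by decide)]
    exact Submodule.mem_sup_right (vec_mem_of_lt _ hlt)
  have hab' := sub_mem hmem (hle hab)
  rw [sub_sub_cancel, hF 0 (by decide), hF 1 (by decide), h0, h1] at hab'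
  obtain ⟨rfl, rfl⟩ := independent_of_term_ne_zero h' (by decide) hab'
  rw [zero_smul, zero_smul, add_zero, sub_zero] at hab
  exact vec_notMem_of_term_ne_zero h 2 hab

/-- Allowing two tuples serves twice: `F = F'` gives the counting bound, and distinct last flags
agreeing at one level are matched index by index in the rigidity argument. -/
theorem index_eq_of_term_ne_zero (hF : ∀ i, i ≠ 3 → F i = F' i) (h : term F J ≠ 0)
    (h' : term F' J' ≠ 0) (hJ : J 3 = J' 3)
    (h3 : (F 3).subspace (J 3).castSucc = (F' 3).subspace (J 3).castSucc)
    (hd₂ : finrank ℂ (span₂ F J) = finrank ℂ (span₂ F' J'))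
    (hd₃ : finrank ℂ (span₃ F J) = finrank ℂ (span₃ F' J')) : J = J' := by
  have hF' : ∀ i, i ≠ 3 → F' i = F i := fun i hi => (hF i hi).symm
  have h3' : (F 3).subspace (J 3).castSucc = (F' 3).subspace (J' 3).castSucc := by rw [h3, hJ]
  have e0 : J 0 = J' 0 := le_antisymm
    (not_lt.1 (not_lt_zero_of_term_ne_zero hF' h' h3'.symm hd₂.symm))
    (not_lt.1 (not_lt_zero_of_term_ne_zero hF h h3' hd₂))
  have s2 : span₂ F J = span₂ F' J' := by rw [span₂, span₂, h3', e0, hF 0 (by decide)]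
  have e1 : J 1 = J' 1 := le_antisymm
    (not_lt.1 (not_lt_one_of_term_ne_zero hF' h' s2.symm hd₃.symm))
    (not_lt.1 (not_lt_one_of_term_ne_zero hF h s2 hd₃))
  have s3 : span₃ F J = span₃ F' J' := by rw [span₃, span₃, s2, e1, hF 1 (by decide)]
  have e2 : J 2 = J' 2 := le_antisymm
    (not_lt.1 (not_lt_two_of_term_ne_zero hF' h' h e0.symm e1.symm s3.symm))
    (not_lt.1 (not_lt_two_of_term_ne_zero hF h h' e0 e1 s3))
  funext i
  fin_cases i
  exacts [e0, e1, e2, hJ]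

end Injectivity

/-- The possible values `(d₃, d₂, d₁)` of the dimensions of the partial spans of nonzero terms. -/
def dimensionTriples (m : ℕ) : Finset (Σ _ : ℕ, Σ _ : ℕ, ℕ) :=
  (Finset.range m).sigma fun d₃ => (Finset.range (d₃ + 1)).sigma fun d₂ => Finset.range (d₂ + 1)

theorem card_dimensionTriples (n : ℕ) :
    ((dimensionTriples (n - 1)).card : ℝ) = n * (n ^ 2 - 1) / 6 := by
  have h1 : ∀ d : ℕ, ((∑ x ∈ Finset.range (d + 1), (x + 1) : ℕ) : ℝ) = (d + 1) * (d + 2) / 2 := by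
    intro d
    induction d with
    | zero => norm_num
    | succ d ih =>
      rw [Finset.sum_range_succ, Nat.cast_add, ih]
      push_cast
      ring
  have h2 : ∀ m : ℕ, ((dimensionTriples m).card : ℝ) = m * (m + 1) * (m + 2) / 6 := by
    intro m
    simp only [dimensionTriples, Finset.card_sigma, Finset.card_range]
    induction m with
    | zero => norm_num
    | succ m ih =>
      rw [Finset.sum_range_succ, Nat.cast_add, ih, h1]
      push_cast
      ring
  rw [h2]
  -- At `n = 0` the truncated `n - 1` is `0`, and both sides still vanish.
  cases n with
  | zero => norm_num
  | succ n => push_cast; simp; ring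

open Classical in
/-- The multi-indices of the nonzero terms. -/
def support (F : Fin 4 → AffineFlag n) : Finset (Fin 4 → Fin n) :=
  Finset.univ.filter fun J => term F J ≠ 0

theorem mem_support {F : Fin 4 → AffineFlag n} {J : Fin 4 → Fin n} :
    J ∈ support F ↔ term F J ≠ 0 := by simp [support]

/-- The dimensions of the partial spans. -/
def dimensions (F : Fin 4 → AffineFlag n) (J : Fin 4 → Fin n) : Σ _ : ℕ, Σ _ : ℕ, ℕ :=
  ⟨finrank ℂ (span₃ F J), finrank ℂ (span₂ F J), J 3⟩

theorem dimensions_mem (F : Fin 4 → AffineFlag n) {J : Fin 4 → Fin n} (hJ : J ∈ support F) :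
    dimensions F J ∈ dimensionTriples (n - 1) := by
  have h := finrank_lowerSpan_of_term_ne_zero (mem_support.1 hJ)
  have h1 := Submodule.finrank_mono (span₃_le_lowerSpan F J)
  have h2 : finrank ℂ (span₂ F J) ≤ finrank ℂ (span₃ F J) :=
    Submodule.finrank_mono le_sup_left
  have h3 : finrank ℂ ((F 3).subspace (J 3).castSucc) ≤ finrank ℂ (span₂ F J) :=
    Submodule.finrank_mono le_sup_left
  rw [(F 3).finrank_subspace, Fin.val_castSucc] at h3
  simp only [dimensionTriples, dimensions, Finset.mem_sigma, Finset.mem_range]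
  omega

theorem dimensions_injOn (F : Fin 4 → AffineFlag n) :
    Set.InjOn (dimensions F) (support F) := by
  intro J hJ J' hJ' h
  simp only [dimensions, Sigma.mk.injEq, heq_eq_eq] at h
  obtain ⟨h1, h2, h3⟩ := h
  exact index_eq_of_term_ne_zero (fun _ _ => rfl) (mem_support.1 hJ) (mem_support.1 hJ')
    (Fin.ext h3) rfl h2 h1

theorem affineB_eq_sum_support (F : Fin 4 → AffineFlag n) :
    affineB F = ∑ J ∈ support F, term F J := by
  classical
  rw [support, Finset.sum_filter_ne_zero]
  rfl

/-- Equality case of `|∑ t i| ≤ card * c ≤ N * c`. The clause `N * t i = ∑ t i` encodes the common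
sign, so that terms of two tuples with equal sums can be compared. -/
theorem card_eq_and_eq_of_abs_sum_eq {ι : Type*} (s : Finset ι) (t : ι → ℝ) (N c : ℝ) (hc : 0 < c)
    (hs : (s.card : ℝ) ≤ N) (ht : ∀ i ∈ s, |t i| ≤ c) (h : |∑ i ∈ s, t i| = N * c) :
    (s.card : ℝ) = N ∧ ∀ i ∈ s, |t i| = c ∧ N * t i = ∑ i ∈ s, t i := by
  have main : ∀ u : ι → ℝ, (∀ i ∈ s, |u i| ≤ c) → ∑ i ∈ s, u i = N * c →
      (s.card : ℝ) = N ∧ ∀ i ∈ s, u i = c := by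
    intro u hu hsum
    have hle : ∀ i ∈ s, u i ≤ c := fun i hi => (le_abs_self _).trans (hu i hi)
    have h1 : ∑ i ∈ s, u i ≤ s.card * c := by
      have := Finset.sum_le_sum hle
      simpa using this
    have hcard : (s.card : ℝ) = N := by
      refine le_antisymm hs ?_
      rw [hsum] at h1
      exact le_of_mul_le_mul_right h1 hc
    refine ⟨hcard, (Finset.sum_eq_sum_iff_of_le hle).1 ?_⟩
    rw [hsum, ← hcard]
    simp
  rcases abs_choice (∑ i ∈ s, t i) with h' | h'
  · obtain ⟨h1, h2⟩ := main t ht (h' ▸ h)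
    refine ⟨h1, fun i hi => ?_⟩
    rw [h2 i hi, abs_of_pos hc, ← h, h']
    exact ⟨rfl, rfl⟩
  · obtain ⟨h1, h2⟩ := main (fun i => -t i) (fun i hi => (abs_neg (t i)).le.trans (ht i hi))
      (by rw [Finset.sum_neg_distrib, ← h', h])
    refine ⟨h1, fun i hi => ?_⟩
    have := h2 i hi
    rw [show t i = -c by linarith, abs_neg, abs_of_pos hc]
    refine ⟨rfl, ?_⟩
    rw [h] at h'
    linarith

/-- For a maximal tuple, all nonzero terms are maximal and equal, and all dimensions occur. -/
theorem maximal_terms {F : Fin 4 → AffineFlag n}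
    (h : |affineB F| = (n : ℝ) * ((n : ℝ) ^ 2 - 1) / 6 * v₃) :
    (∀ x ∈ dimensionTriples (n - 1), ∃ J ∈ support F, dimensions F J = x) ∧
      ∀ J ∈ support F, |term F J| = v₃ ∧ (n : ℝ) * ((n : ℝ) ^ 2 - 1) / 6 * term F J = affineB F := by
  have hcard : (support F).card ≤ (dimensionTriples (n - 1)).card :=
    Finset.card_le_card_of_injOn (dimensions F) (fun J hJ => dimensions_mem F hJ)
      (dimensions_injOn F)
  rw [affineB_eq_sum_support, ← card_dimensionTriples] at *
  obtain ⟨h1, h2⟩ := card_eq_and_eq_of_abs_sum_eq (support F) (term F) _ v₃ v₃_pos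
    (by exact_mod_cast hcard) (fun J _ => abs_Vol_le _) h
  refine ⟨fun x hx => ?_, h2⟩
  obtain ⟨J, hJ, hx⟩ := Finset.surj_on_of_inj_on_of_card_le (fun J _ => dimensions F J)
    (fun J hJ => dimensions_mem F hJ) (fun J J' hJ hJ' h => dimensions_injOn F hJ hJ' h)
    (by exact_mod_cast h1.ge) x hx
  exact ⟨J, hJ, hx.symm⟩

end

section

open Module

/-! ## Rigidity -/

variable {n : ℕ}

/-- The triple `(n - 2, d, k)` occurs for both tuples, at the same index since their last flags
agree at level `k`. There the lower and upper spans coincide, and the terms are equal and maximal.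
-/
theorem exists_common_index {F F' : Fin 4 → AffineFlag n} (hF : ∀ i, i ≠ 3 → F i = F' i)
    (h : |affineB F| = (n : ℝ) * ((n : ℝ) ^ 2 - 1) / 6 * v₃) (he : affineB F' = affineB F)
    {k : Fin n} (hk : (F 3).subspace k.castSucc = (F' 3).subspace k.castSucc) {d : ℕ}
    (hkd : k ≤ d) (hd : d + 2 ≤ n) :
    ∃ J : Fin 4 → Fin n, J 3 = k ∧ finrank ℂ (span₂ F J) = d ∧ finrank ℂ (span₃ F J) + 2 = n ∧
      term F J ≠ 0 ∧
      ∃ r : ℂ, (F' 3).vec k - r • (F 3).vec k ∈ lowerSpan F J := by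
  obtain ⟨hs, ht⟩ := maximal_terms h
  obtain ⟨hs', ht'⟩ := maximal_terms (he ▸ h)
  have hx : (⟨n - 2, d, (k : ℕ)⟩ : Σ _ : ℕ, Σ _ : ℕ, ℕ) ∈ dimensionTriples (n - 1) := by
    simp only [dimensionTriples, Finset.mem_sigma, Finset.mem_range]
    omega
  obtain ⟨J, hJ, hJx⟩ := hs _ hx
  obtain ⟨J', hJ', hJx'⟩ := hs' _ hx
  simp only [dimensions, Sigma.mk.injEq, heq_eq_eq] at hJx hJx'
  obtain ⟨a1, a2, a3⟩ := hJx
  obtain ⟨b1, b2, b3⟩ := hJx'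
  obtain rfl : J 3 = k := Fin.ext a3
  have hT := mem_support.1 hJ
  obtain rfl : J = J' := index_eq_of_term_ne_zero hF hT (mem_support.1 hJ')
    (Fin.ext b3.symm) hk (a2.trans b2.symm) (a1.trans b1.symm)
  refine ⟨J, rfl, a2, by omega, hT, ?_⟩
  have hlow : lowerSpan F J = lowerSpan F' J := by
    simp only [lowerSpan_eq, span₃, span₂, hk, hF 0 (by decide), hF 1 (by decide),
      hF 2 (by decide)]
  have hup : upperSpan F J = upperSpan F' J := by
    rw [upperSpan_eq_of_term_ne_zero hT (i := 0) (j := 1) (by decide),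
      upperSpan_eq_of_term_ne_zero (mem_support.1 hJ') (i := 0) (j := 1) (by decide), hlow,
      hF 0 (by decide), hF 1 (by decide)]
  have hN : (n : ℝ) * ((n : ℝ) ^ 2 - 1) / 6 ≠ 0 := by
    rw [← card_dimensionTriples]
    exact_mod_cast (Finset.card_pos.2 ⟨_, hx⟩).ne'
  refine exists_sub_smul_mem_lowerSpan hF hlow hup (ht J hJ).1 (mul_left_cancel₀ hN ?_)
  rw [(ht J hJ).2, (ht' J hJ').2, he]

theorem subspace_succ_eq {F F' : Fin 4 → AffineFlag n} (hF : ∀ i, i ≠ 3 → F i = F' i)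
    (h : |affineB F| = (n : ℝ) * ((n : ℝ) ^ 2 - 1) / 6 * v₃) (he : affineB F' = affineB F)
    {k : Fin n} (hk : (F 3).subspace k.castSucc = (F' 3).subspace k.castSucc)
    (hkn : (k : ℕ) + 2 ≤ n) : (F 3).subspace k.succ = (F' 3).subspace k.succ := by
  set G := (F 3).subspace k.castSucc with hG
  set x := (F 3).vec k
  set y := (F' 3).vec k
  -- With `d = n - 2` the span of flags 3 and 0 already fills the lower span.
  obtain ⟨A, hA3, hA2, hA1, hA, r, hr⟩ :=
    exists_common_index hF h he hk (d := n - 2) (by omega) (by omega)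
  have hlow : lowerSpan F A = span₂ F A := by
    refine (Submodule.eq_of_le_of_finrank_le (span₂_le_lowerSpan F A) ?_).symm
    have := finrank_lowerSpan_of_term_ne_zero hA
    omega
  have hspan : ∀ J : Fin 4 → Fin n, J 3 = k →
      span₂ F J = G ⊔ (F 0).subspace (J 0).castSucc := fun J hJ => by rw [span₂, hJ]
  rw [hlow, hspan A hA3] at hr
  -- Descent along flag 0. Only the levels where the sum with `G` really grows need an argument.
  have step : ∀ j : Fin n, j < A 0 → y - r • x ∈ G ⊔ (F 0).subspace j.succ →
      y - r • x ∈ G ⊔ (F 0).subspace j.castSucc := by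
    intro j hj hmem
    by_cases hv : (F 0).vec j ∈ G ⊔ (F 0).subspace j.castSucc
    · rw [(F 0).subspace_succ] at hmem
      refine (sup_le le_sup_left (sup_le ?_ le_sup_right) :
        G ⊔ (Submodule.span ℂ {(F 0).vec j} ⊔ (F 0).subspace j.castSucc) ≤ _) hmem
      exact (Submodule.span_singleton_le_iff_mem _ _).2 hv
    · have hmono : ∀ i i' : Fin n, i ≤ i' →
          G ⊔ (F 0).subspace i.castSucc ≤ G ⊔ (F 0).subspace i'.castSucc := fun i i' hi =>
        sup_le_sup_left ((F 0).monotone_subspace (Fin.castSucc_le_castSucc_iff.2 hi)) _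
      have hd1 : (k : ℕ) ≤ finrank ℂ ↥(G ⊔ (F 0).subspace j.castSucc) := by
        have := Submodule.finrank_mono (le_sup_left : G ≤ G ⊔ (F 0).subspace j.castSucc)
        rwa [hG, (F 3).finrank_subspace, Fin.val_castSucc] at this
      have hd2 : finrank ℂ ↥(G ⊔ (F 0).subspace j.castSucc) + 2 ≤ n := by
        have := Submodule.finrank_mono (hmono j (A 0) hj.le)
        rw [← hspan A hA3] at this
        omega
      obtain ⟨J, hJ3, hJ2, -, hJ, s, hs⟩ := exists_common_index hF h he hk hd1 hd2
      rw [hspan J hJ3] at hJ2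
      have hle := span₂_le_lowerSpan F J
      rw [hspan J hJ3] at hle
      -- The sum with `G` has the same dimension at `J 0` and `j`, so the two sums agree. `J 0 < j`
      -- would kill the term; `j < J 0` would contradict the growth at `j`.
      have hj0 : J 0 = j := by
        rcases lt_trichotomy (J 0) j with hlt | heq | hlt
        · exfalso
          have := Submodule.eq_of_le_of_finrank_eq (hmono _ _ hlt.le) hJ2
          refine vec_notMem_of_term_ne_zero hJ 0 (hle ?_)
          rw [this]
          exact Submodule.mem_sup_right (vec_mem_of_lt _ hlt)
        · exact heq
        · exfalso
          have := Submodule.eq_of_le_of_finrank_eq (hmono _ _ hlt.le) hJ2.symm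
          apply hv
          rw [this]
          exact Submodule.mem_sup_right (vec_mem_of_lt _ hlt)
      rw [hj0] at hle
      rw [(F 0).subspace_succ, sup_left_comm, Submodule.mem_sup] at hmem
      obtain ⟨z, hz, g, hg, hzg⟩ := hmem
      obtain ⟨t, rfl⟩ := Submodule.mem_span_singleton.1 hz
      -- Eliminate `y` between `y - r x = t v₀ + g` and `y - s x ∈ lowerSpan F J`. Independence of
      -- the vectors of flags 3 and 0 then gives `t = 0`.
      have hcomb : (s - r) • (F 3).vec (J 3) + (-t) • (F 0).vec (J 0) ∈ lowerSpan F J := by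
        have h1 := sub_mem (hle hg) hs
        rw [hJ3, hj0]
        convert h1 using 1
        rw [eq_sub_of_add_eq' hzg]
        module
      have ht := (independent_of_term_ne_zero hJ (by decide) hcomb).2
      rw [neg_eq_zero] at ht
      rw [ht, zero_smul, zero_add] at hzg
      rwa [← hzg]
  have hall : ∀ i : ℕ, ∀ j : Fin n, (j : ℕ) + i = A 0 →
      y - r • x ∈ G ⊔ (F 0).subspace j.castSucc := by
    intro i
    induction i with
    | zero =>
      intro j hj
      obtain rfl : j = A 0 := Fin.ext hj
      exact hr
    | succ i ih =>
      intro j hj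
      have hlt : (j : ℕ) < A 0 := by omega
      have hn := (A 0).isLt
      refine step j hlt ?_
      exact ih ⟨j + 1, by omega⟩ (by simp only; omega)
  have hzero : y - r • x ∈ G := by
    have h0 := hall (A 0) ⟨0, by omega⟩ (by simp)
    have hbot : (F 0).subspace (Fin.castSucc ⟨0, by omega⟩ : Fin (n + 1)) = ⊥ := by
      rw [← Submodule.finrank_eq_zero (R := ℂ), (F 0).finrank_subspace]
      rfl
    rwa [hbot, sup_bot_eq] at h0
  refine (Submodule.eq_of_le_of_finrank_eq ?_ ?_).symm
  · rw [(F' 3).subspace_succ, (F 3).subspace_succ, ← hk]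
    refine sup_le ((Submodule.span_singleton_le_iff_mem _ _).2 ?_) le_sup_right
    change y ∈ _
    rw [← sub_add_cancel y (r • x)]
    exact add_mem (Submodule.mem_sup_right hzero)
      (Submodule.mem_sup_left (Submodule.smul_mem _ _ (Submodule.mem_span_singleton_self _)))
  · rw [(F' 3).finrank_subspace, (F 3).finrank_subspace]

/-! ### Complete flags, their affine lifts and their extreme members -/

theorem CompleteFlag.toAffine_toCompleteFlag (F : CompleteFlag n) :
    F.toAffine.toCompleteFlag = F := F.exists_affineFlag.choose_spec

theorem CompleteFlag.subspace_last (F : CompleteFlag n) : F.subspace (Fin.last n) = ⊤ := by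
  apply Submodule.eq_top_of_finrank_eq
  rw [F.finrank_subspace, finrank_fin_fun, Fin.val_last]

theorem CompleteFlag.subspace_zero (F : CompleteFlag n) : F.subspace 0 = ⊥ := by
  rw [← Submodule.finrank_eq_zero (R := ℂ), F.finrank_subspace]
  rfl

end

end FlagVolume

end

theorem mainTheorem6 (n : ℕ) (F₀ F₁ F₂ F₃ F : FlagVolume.CompleteFlag n)
    (hmax : |FlagVolume.B ![F₀, F₁, F₂, F₃]| =
      (n : ℝ) * ((n : ℝ) ^ 2 - 1) / 6 * FlagVolume.v₃)
    (hF : FlagVolume.B ![F₀, F₁, F₂, F] = FlagVolume.B ![F₀, F₁, F₂, F₃]) :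
    F = F₃ := by
  set A : Fin 4 → FlagVolume.AffineFlag n := fun i => (![F₀, F₁, F₂, F₃] i).toAffine with hA
  set A' : Fin 4 → FlagVolume.AffineFlag n := fun i => (![F₀, F₁, F₂, F] i).toAffine with hA'
  -- The lift depends only on the flag, so equal flags have the same chosen vectors.
  have hAA : ∀ i, i ≠ 3 → A i = A' i := by
    intro i hi
    fin_cases i
    · rfl
    · rfl
    · rfl
    · exact absurd rfl hi
  have h3 : (A 3).toCompleteFlag = F₃ := FlagVolume.CompleteFlag.toAffine_toCompleteFlag F₃
  have h3' : (A' 3).toCompleteFlag = F := FlagVolume.CompleteFlag.toAffine_toCompleteFlag F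
  rw [← h3, ← h3']
  apply FlagVolume.CompleteFlag.ext
  funext j
  symm
  induction j using Fin.induction with
  | zero => rw [FlagVolume.CompleteFlag.subspace_zero, FlagVolume.CompleteFlag.subspace_zero]
  | succ k ih =>
    -- The rigidity step needs a plane in the quotient, hence `k ≤ n - 2`; the remaining level is
    -- the whole space.
    by_cases hk : (k : ℕ) + 2 ≤ n
    · exact FlagVolume.subspace_succ_eq hAA hmax hF ih hk
    · have hlast : k.succ = Fin.last n := Fin.ext (by
        have := k.isLt
        simp only [Fin.val_succ, Fin.val_last]
        omega)
      rw [hlast, FlagVolume.CompleteFlag.subspace_last, FlagVolume.CompleteFlag.subspace_last]
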